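/- For $\tau$ in the upper half-plane $\mathcal H$ put $\Lambda_\tau=\mathbb Z\oplus\tau\mathbb Z$. Let $\wp(\tau,z)=\frac1{z^2}+\sum_{w\in\Lambda_\tau\setminus\{0\}}\left(\frac1{(z-w)^2}-\frac1{w^2}\right)$ be the Weierstrass function of $\Lambda_\tau$, let $\partial_z\wp$ be its derivative in $z$, and let $e_4(\tau,z)=e_4(\tau)=\sum_{w\in\Lambda_\tau\setminus\{0\}}w^{-4}$. A complex-valued function $f$ on $\mathcal H\times\mathbb C$ (possibly with poles at the points $(\tau,z)$ with $z\in\Lambda_\tau$) is called singular if - for every $\tau\in\mathcal H$, the function $z\mapsto f(\tau,z)$ is $1$-periodic and meromorphic on $\mathbb C$, has no poles outside $\Lambda_\tau$, and has the same pole order at all points of $\Lambda_\tau$ (order $0$ meaning no pole), this order being bounded by a constant independent of $\tau$; - $\tau\mapsto f(\tau,z)$ is $1$-periodic; - for every $n\in\mathbb Z$, the $n$-th Laurent coefficient $A_n(\tau)$ of $z\mapsto f(\tau,z)$ at $z=0$ is holomorphic on $\mathcal H$ and at infinity, that is, $A_n(\tau)=\sum_{r\ge0}\widehat A_n(r)e^{2i\pi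 r\tau}$ on $\mathcal H$. For an integer $k\ge 0$, a singular Jacobi form of index $0$ and weight $k$ is a singular function $f$ such that $$(c\tau+d)^{-k}f\left(\frac{a\tau+b}{c\tau+d},\frac{z+\lambda\tau+\mu}{c\tau+d}\right)=f(\tau,z)$$ for all $\begin{pmatrix}a&b\\c&d\end{pmatrix}\in\mathrm{SL}(2,\mathbb Z)$ and $(\lambda,\mu)\in\mathbb Z^2$. Functions are identified when they agree at all $(\tau,z)$ with $z\notin\Lambda_\tau$. **Theorem.** 1. The functions $\wp$, $\partial_z\wp$ and $e_4$ are algebraically independent over $\mathbb C$. 2. The algebra $\mathrm{JS}=\mathbb C[\wp,\partial_z\wp,e_4]$ is graded by the weight: $\mathrm{JS}=\bigoplus_{k\in\mathbb N}\mathrm{JS}_k$ and $\mathrm{JS}_k\,\mathrm{JS}_\ell\subset\mathrm{JS}_{k+\ell}$, where $\mathrm{JS}_k$ is the set of the finite sums $\sum_{2a+3b+4c=k}\alpha(a,b,c)\,\wp^a(\partial_z\wp)^b e_4^c$ with $(a,b,c)\in\mathbb N^3$ and $\alpha(a,b,c)\in\mathbb C$. 3. For every integer $k\ge 0$, $\mathrm{JS}_k$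 is the set of singular Jacobi forms of index $0$ and weight $k$. Hence the algebra spanned by the singular Jacobi forms of index $0$ and all weights $k\ge0$ is $\mathbb C[\wp,\partial_z\wp,e_4]$. -/

import Mathlib

open UpperHalfPlane
open scoped Topology Manifold MatrixGroups

namespace SingularJacobi

/-- The period pair `(1, τ)`; its lattice is `ℤ ⊕ τℤ`. -/
noncomputable def periods (τ : ℍ) : PeriodPair where
  ω₁ := 1
  ω₂ := (τ : ℂ)
  indep := by
    rw [LinearIndependent.pair_iff]
    intro s t h
    have him := congrArg Complex.im h
    have hre := congrArg Complex.re h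
    simp at him hre
    have ht : t = 0 := him.resolve_right τ.im_ne_zero
    subst ht
    simpa using hre

/-- The pairs `(τ, z)` in `ℍ × ℂ` with `z` not in the lattice `ℤ ⊕ τℤ`. -/
abbrev Dom : Type := {p : ℍ × ℂ // p.2 ∉ (periods p.1).lattice}

/-- Functions of `(τ, z)`, given by their values off the lattice `ℤ ⊕ τℤ`. A meromorphic function of
`z` all of whose poles are lattice points is determined by these values; pointwise operations make
this a commutative `ℂ`-algebra. -/
abbrev Fun : Type := Dom → ℂ

open Classical in
/-- The function on `ℍ × ℂ` attached to `f`. Its value at lattice points, where `f` may have poles,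
is the placeholder `0`; no notion below depends on it. -/
noncomputable def Fun.ext (f : Fun) (τ : ℍ) (z : ℂ) : ℂ :=
  if h : z ∉ (periods τ).lattice then f ⟨(τ, z), h⟩ else 0

/-- The Weierstrass function `℘(τ, z)` of the lattice `ℤ ⊕ τℤ`. -/
noncomputable def wp : Fun := fun p ↦ (periods p.1.1).weierstrassP p.1.2

/-- The derivative `∂_z ℘`. -/
noncomputable def dwp : Fun := fun p ↦ deriv (periods p.1.1).weierstrassP p.1.2

/-- The Eisenstein function `e₄(τ) = ∑ w⁻⁴`, the sum over nonzero `w ∈ ℤ ⊕ τℤ` (the term `w = 0` is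
`0` by the convention `0⁻¹ = 0`), as a function of `(τ, z)`. -/
noncomputable def e4 : Fun := fun p ↦ (periods p.1.1).G 4

/-- The order of the pole of `g` at `w`; it is `0` when `g` has no pole at `w`. -/
noncomputable def poleOrderAt (g : ℂ → ℂ) (w : ℂ) : ℕ :=
  (-(meromorphicOrderAt g w).untopD 0).toNat

/-- `a` is the family of Laurent coefficients of `g` at `0` (with finite principal part). -/
def HasLaurentExpansionAtZero (g : ℂ → ℂ) (a : ℤ → ℂ) : Prop :=
  (∃ N : ℕ, ∀ n : ℤ, n < -(N : ℤ) → a n = 0) ∧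
    ∀ᶠ z in 𝓝[≠] (0 : ℂ), HasSum (fun n : ℤ ↦ a n * z ^ n) (g z)

/-- `A` has a Fourier expansion `A(τ) = ∑_{r ≥ 0} c(r) exp(2πirτ)`. -/
def HasFourierExpansion (A : ℍ → ℂ) : Prop :=
  ∃ c : ℕ → ℂ, ∀ τ : ℍ,
    HasSum (fun r : ℕ ↦ c r * Complex.exp (2 * Real.pi * Complex.I * r * τ)) (A τ)

/-- Singular functions. -/
structure IsSingular (f : Fun) : Prop where
  /-- `z ↦ f(τ, z)` is `1`-periodic. -/
  periodic_z : ∀ (τ : ℍ) (z : ℂ), f.ext τ (z + 1) = f.ext τ z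
  /-- `z ↦ f(τ, z)` is meromorphic on `ℂ`. -/
  meromorphic : ∀ τ : ℍ, Meromorphic (f.ext τ)
  /-- The only poles of `z ↦ f(τ, z)` are points of `ℤ ⊕ τℤ`. -/
  analyticAt : ∀ (τ : ℍ) (z : ℂ), z ∉ (periods τ).lattice → AnalyticAt ℂ (f.ext τ) z
  /-- All lattice points have the same pole order. -/
  same_order : ∀ (τ : ℍ), ∀ w ∈ (periods τ).lattice,
    poleOrderAt (f.ext τ) w = poleOrderAt (f.ext τ) 0
  /-- The pole order is bounded independently of `τ`. -/
  order_bound : ∃ N : ℕ, ∀ τ : ℍ, poleOrderAt (f.ext τ) 0 ≤ N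
  /-- `τ ↦ f(τ, z)` is `1`-periodic. -/
  periodic_tau : ∀ (τ : ℍ) (z : ℂ), f.ext ((1 : ℝ) +ᵥ τ) z = f.ext τ z
  /-- The Laurent coefficients at `z = 0` are holomorphic on `ℍ` and at infinity. -/
  laurent : ∃ A : ℤ → ℍ → ℂ,
    (∀ τ : ℍ, HasLaurentExpansionAtZero (f.ext τ) (fun n ↦ A n τ)) ∧
    ∀ n : ℤ, MDifferentiable 𝓘(ℂ) 𝓘(ℂ) (A n) ∧ HasFourierExpansion (A n)

/-- The action `F|_{k,m} A` of `A = (g, (l, μ))` in `SL(2, ℤ) ⋉ ℤ²`, weight `k`, index `m`. -/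
noncomputable def slash (k m : ℕ) (g : SL(2, ℤ)) (l μ : ℤ) (F : ℍ → ℂ → ℂ) (τ : ℍ) (z : ℂ) : ℂ :=
  (((g 1 0 : ℂ) * τ + g 1 1) ^ k)⁻¹ *
    Complex.exp (2 * Real.pi * Complex.I * m *
      (-((g 1 0 : ℂ) * (z + l * τ + μ) ^ 2 / ((g 1 0 : ℂ) * τ + g 1 1)) + l ^ 2 * τ + 2 * l * z)) *
    F (g • τ) ((z + l * τ + μ) / ((g 1 0 : ℂ) * τ + g 1 1))

/-- Singular Jacobi forms of weight `k` and index `m`. -/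
structure IsSingularJacobiForm (k m : ℕ) (f : Fun) : Prop where
  singular : IsSingular f
  slash_eq : ∀ (g : SL(2, ℤ)) (l μ : ℤ), slash k m g l μ f.ext = f.ext

/-- The algebra `ℂ[℘, ∂_z ℘, e₄]` of elliptic forms. -/
noncomputable def JS : Subalgebra ℂ Fun := Algebra.adjoin ℂ {wp, dwp, e4}

/-- The linear combinations of the `℘^a (∂_z ℘)^b e₄^c` with `2a + 3b + 4c = k`. -/
noncomputable def JSk (k : ℕ) : Submodule ℂ Fun :=
  Submodule.span ℂ {f | ∃ a b c : ℕ, 2 * a + 3 * b + 4 * c = k ∧ f = wp ^ a * dwp ^ b * e4 ^ c}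

end SingularJacobi

/-! Let `f` be invariant of weight `k`, with a pole of order at most `N` at `z = 0`. Invariance
under `z ↦ z / (cτ + d)` makes the coefficient of `z⁻ᴺ` transform with weight `k - N`, so it is a
level-one modular form `A`, hence a polynomial in `G₄` and `G₆` (`modularForm_mem_eisSpan`). By the
Weierstrass equation `G₆` is a polynomial in `℘`, `∂_z ℘` and `e₄`. If `N ≥ 2`, some `℘^a (∂_z ℘)^b`
has pole order exactly `N`, and subtracting a multiple of `A ℘^a (∂_z ℘)^b` lowers the order. If `N
= 1`, the residue vanishes (`residue_eq_zero_of_simple_pole`). If `N = 0`, Liouville's theorem makes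
`f` a modular form in `τ` alone. This descent is `mem_JSk_of_hasExpansion`; conversely, the
generators have explicit expansions with Eisenstein coefficients. Distinct weights are independent
because `cτ + d` takes infinitely many values for fixed `τ`. For algebraic independence, the parity
of `℘` and `∂_z ℘` reduces a relation to one between `℘`, `G₄` and `G₆`. These become free variables
because `℘(τ, ·)`, `cτ + d` and `G₄³ / G₆²` each take infinitely many values. -/

namespace PeriodPair

/-! ### Elliptic functions for a fixed lattice. -/

open Filter

variable (L : PeriodPair)

lemma eventually_nhdsNE_zero_notMem_lattice : ∀ᶠ z in 𝓝[≠] (0 : ℂ), z ∉ L.lattice := by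
  filter_upwards [self_mem_nhdsWithin, mem_nhdsWithin_of_mem_nhds
    (L.compl_lattice_sdiff_singleton_mem_nhds 0)] with z hz hz'
  simp_all

lemma eventually_notMem_lattice {z : ℂ} (hz : z ∉ L.lattice) : ∀ᶠ w in 𝓝 z, w ∉ L.lattice :=
  L.isClosed_lattice.isOpen_compl.mem_nhds hz

lemma add_mem_lattice_iff {z l : ℂ} (hl : l ∈ L.lattice) : z + l ∈ L.lattice ↔ z ∈ L.lattice :=
  L.lattice.toAddSubgroup.add_mem_cancel_right (y := z) hl

/-- Liouville's theorem for elliptic functions: an elliptic function which is holomorphic off the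
lattice and has a removable singularity at `0` is constant. -/
theorem eq_of_analyticAt_of_periodic {h φ : ℂ → ℂ}
    (han : ∀ z ∉ L.lattice, AnalyticAt ℂ h z)
    (hper : ∀ z ∉ L.lattice, ∀ l ∈ L.lattice, h (z + l) = h z)
    (hφ : AnalyticAt ℂ φ 0) (hh : ∀ᶠ z in 𝓝[≠] 0, h z = φ z) :
    ∀ z ∉ L.lattice, h z = φ 0 := by
  classical
  -- Filling every lattice point with the limit at `0` gives an entire periodic function, bounded
  -- because its range is compact.
  set H : ℂ → ℂ := fun z ↦ if z ∈ L.lattice then φ 0 else h z with hH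
  have hHper (z l : ℂ) (hl : l ∈ L.lattice) : H (z + l) = H z := by
    simp only [hH, L.add_mem_lattice_iff hl]
    split_ifs with hz
    · rfl
    · exact hper z hz l hl
  have h0 : AnalyticAt ℂ H 0 := by
    refine hφ.congr ?_
    have := hh.and L.eventually_nhdsNE_zero_notMem_lattice
    rw [eventually_nhdsWithin_iff] at this
    filter_upwards [this] with z hz
    by_cases hz0 : z = 0
    · simp [hH, hz0]
    · obtain ⟨h1, h2⟩ := hz hz0
      simp [hH, h2, h1]
  have hHan (z : ℂ) : AnalyticAt ℂ H z := by
    by_cases hz : z ∈ L.lattice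
    · rw [← sub_self z] at h0
      have := h0.comp (f := (· - z)) (by fun_prop)
      refine this.congr (.of_forall fun w ↦ ?_)
      simpa [sub_eq_add_neg] using hHper w (-z) (neg_mem hz)
    · refine (han z hz).congr ?_
      filter_upwards [L.eventually_notMem_lattice hz] with w hw
      simp [hH, hw]
  have hdiff : Differentiable ℂ H := fun z ↦ (hHan z).differentiableAt
  intro z hz
  have := hdiff.apply_eq_apply_of_bounded (IsZLattice.isCompact_range_of_periodic L.lattice _
    hdiff.continuous hHper).isBounded z 0
  simpa [hH, hz] using this

lemma tendsto_weierstrassP_cobounded :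
    Tendsto L.weierstrassP (𝓝[≠] 0) (Bornology.cobounded ℂ) := by
  rw [tendsto_cobounded_iff_meromorphicOrderAt_neg (L.meromorphic_weierstrassP 0),
    L.order_weierstrassP 0 (zero_mem _)]
  decide

/-- A finite image would be bounded, against the pole at `0`. Infinitely many values let an identity
in `℘` be read as a polynomial identity. -/
lemma infinite_image_weierstrassP : (L.weierstrassP '' {z | z ∉ L.lattice}).Infinite := by
  intro hfin
  have h1 := L.tendsto_weierstrassP_cobounded.eventually
    (Bornology.isBounded_def.mp hfin.isBounded)
  obtain ⟨z, hz, hz'⟩ := (h1.and L.eventually_nhdsNE_zero_notMem_lattice).exists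
  exact hz ⟨z, hz', rfl⟩

lemma weierstrassP_eq_of_ne_zero (z : ℂ) :
    L.weierstrassP z = L.weierstrassPExcept 0 z + (z ^ 2)⁻¹ := by
  simpa using (L.weierstrassPExcept_add 0 z).symm

lemma derivWeierstrassP_eq_of_ne_zero (z : ℂ) :
    L.derivWeierstrassP z = L.derivWeierstrassPExcept 0 z - 2 * (z ^ 3)⁻¹ := by
  simpa [div_eq_mul_inv] using (L.derivWeierstrassPExcept_sub 0 z).symm

lemma hasDerivAt_weierstrassP {z : ℂ} (hz : z ∉ L.lattice) :
    HasDerivAt L.weierstrassP (L.derivWeierstrassP z) z := by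
  rw [← L.deriv_weierstrassP]
  exact (L.analyticOnNhd_weierstrassP z hz).differentiableAt.hasDerivAt

/-- An even function analytic at `0` with value `1` there is of the form `1 + z ^ 2 * ψ z`. -/
lemma _root_.AnalyticAt.exists_eq_one_add_sq_mul {φ : ℂ → ℂ} (hφ : AnalyticAt ℂ φ 0)
    (h0 : φ 0 = 1) (heven : ∀ᶠ z in 𝓝 0, φ (-z) = φ z) :
    ∃ ψ : ℂ → ℂ, AnalyticAt ℂ ψ 0 ∧ ∀ᶠ z in 𝓝 0, φ z = 1 + z ^ 2 * ψ z := by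
  have h1 : AnalyticAt ℂ (fun z ↦ φ z - 1) 0 := by fun_prop
  have hd : deriv φ 0 = 0 := by
    have h2 : deriv (fun z ↦ φ (-z)) 0 = deriv φ 0 := Filter.EventuallyEq.deriv_eq heven
    rw [deriv_comp_neg, neg_zero] at h2
    exact CharZero.eq_neg_self_iff.mp h2.symm
  have h2 : ((2 : ℕ) : ℕ∞) ≤ analyticOrderAt (fun z ↦ φ z - 1) 0 := by
    rw [natCast_le_analyticOrderAt_iff_iteratedDeriv_eq_zero h1]
    intro i hi
    interval_cases i
    · simp [h0]
    · simp [iteratedDeriv_one, hd]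
  obtain ⟨ψ, hψ, h3⟩ := (natCast_le_analyticOrderAt h1).mp h2
  refine ⟨ψ, hψ, ?_⟩
  filter_upwards [h3] with z hz
  simp only [sub_zero, smul_eq_mul] at hz
  linear_combination hz

lemma _root_.Polynomial.coeff_eq_zero_of_cubic_of_infinite {a b c : ℂ} {s : Set ℂ}
    (hs : s.Infinite) (h : ∀ x ∈ s, a * x ^ 2 + b * x + c = 0) : a = 0 ∧ b = 0 ∧ c = 0 := by
  open Polynomial in
  have hp : (C a * X ^ 2 + C b * X + C c : ℂ[X]) = 0 := by
    refine Polynomial.eq_zero_of_infinite_isRoot _ (hs.mono fun x hx ↦ ?_)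
    simpa using h x hx
  refine ⟨?_, ?_, ?_⟩
  · simpa [Polynomial.coeff_X, Polynomial.coeff_C] using congrArg (Polynomial.coeff · 2) hp
  · simpa [Polynomial.coeff_X, Polynomial.coeff_C] using congrArg (Polynomial.coeff · 1) hp
  · simpa [Polynomial.coeff_X, Polynomial.coeff_C] using congrArg (Polynomial.coeff · 0) hp

/-- For a lattice with nonvanishing discriminant there is no odd elliptic function whose only
singularities are simple poles of residue `1` at lattice points. -/
lemma not_exists_odd_simple_pole (hΔ : L.g₂ ^ 3 ≠ 27 * L.g₃ ^ 2) {h φ : ℂ → ℂ}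
    (han : ∀ z ∉ L.lattice, AnalyticAt ℂ h z)
    (hper : ∀ z ∉ L.lattice, ∀ l ∈ L.lattice, h (z + l) = h z)
    (hφ : AnalyticAt ℂ φ 0) (hh : ∀ᶠ z in 𝓝[≠] 0, z * h z = φ z)
    (heven : ∀ᶠ z in 𝓝 0, φ (-z) = φ z) : φ 0 ≠ 1 := by
  intro h0
  obtain ⟨ψ, hψ, hφψ⟩ := hφ.exists_eq_one_add_sq_mul h0 heven
  have hnear : ∀ᶠ z in 𝓝[≠] 0, h z = z⁻¹ + z * ψ z := by
    filter_upwards [hh, hφψ.filter_mono nhdsWithin_le_nhds, self_mem_nhdsWithin] with z h1 h2 hz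
    have hz : z ≠ 0 := hz
    field_simp
    linear_combination h1 + h2
  have hψd : ∀ᶠ z in 𝓝 0, AnalyticAt ℂ ψ z := hψ.eventually_analyticAt
  have hPex := L.analyticAt_weierstrassPExcept 0
  have hP := L.analyticOnNhd_weierstrassP
  -- the square of `h`
  obtain ⟨d, hd⟩ : ∃ d : ℂ, ∀ z ∉ L.lattice, h z ^ 2 = L.weierstrassP z + d := by
    refine ⟨_, fun z hz ↦ eq_add_of_sub_eq' (L.eq_of_analyticAt_of_periodic
      (h := fun z ↦ h z ^ 2 - L.weierstrassP z)
      (φ := fun z ↦ 2 * ψ z + z ^ 2 * ψ z ^ 2 - L.weierstrassPExcept 0 z) ?_ ?_ ?_ ?_ z hz)⟩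
    · exact fun z hz ↦ ((han z hz).pow 2).sub (hP z hz)
    · intro z hz l hl
      simp only [hper z hz l hl, L.weierstrassP_add_coe z ⟨l, hl⟩]
    · fun_prop
    · filter_upwards [hnear, self_mem_nhdsWithin] with z h1 hz
      have hz : z ≠ 0 := hz
      rw [h1, L.weierstrassP_eq_of_ne_zero]
      field_simp
      ring
  -- the derivative of `h`
  obtain ⟨e, he⟩ : ∃ e : ℂ, ∀ z ∉ L.lattice, deriv h z = e - L.weierstrassP z := by
    refine ⟨_, fun z hz ↦ eq_sub_of_add_eq (L.eq_of_analyticAt_of_periodic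
      (h := fun z ↦ deriv h z + L.weierstrassP z)
      (φ := fun z ↦ ψ z + z * deriv ψ z + L.weierstrassPExcept 0 z) ?_ ?_ ?_ ?_ z hz)⟩
    · exact fun z hz ↦ (han z hz).deriv.add (hP z hz)
    · intro z hz l hl
      have h1 : deriv h (z + l) = deriv h z := by
        rw [← deriv_comp_add_const]
        refine Filter.EventuallyEq.deriv_eq ?_
        filter_upwards [L.eventually_notMem_lattice hz] with w hw using hper w hw l hl
      simp only [h1, L.weierstrassP_add_coe z ⟨l, hl⟩]
    · have := hψ.deriv
      fun_prop
    · filter_upwards [eventually_eventually_nhdsWithin.mpr hnear, self_mem_nhdsWithin,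
        hψd.filter_mono nhdsWithin_le_nhds] with z h1 hz hz'
      have hz : z ≠ 0 := hz
      rw [nhdsWithin_eq_nhds.mpr (isOpen_compl_singleton.mem_nhds hz)] at h1
      have h2 : HasDerivAt (fun z ↦ z⁻¹ + z * ψ z)
          (-(z ^ 2)⁻¹ + (1 * ψ z + z * deriv ψ z)) z :=
        (hasDerivAt_inv hz).add ((hasDerivAt_id z).mul hz'.differentiableAt.hasDerivAt)
      rw [Filter.EventuallyEq.deriv_eq h1, h2.deriv, L.weierstrassP_eq_of_ne_zero]
      ring
  have hprod (z : ℂ) (hz : z ∉ L.lattice) : 2 * h z * (e - L.weierstrassP z) =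
      L.derivWeierstrassP z := by
    have h1 : HasDerivAt (fun z ↦ h z ^ 2) (2 * h z * deriv h z) z := by
      simpa using (han z hz).differentiableAt.hasDerivAt.fun_pow 2
    have h2 : HasDerivAt (fun z ↦ h z ^ 2) (L.derivWeierstrassP z) z := by
      refine ((L.hasDerivAt_weierstrassP hz).add_const d).congr_of_eventuallyEq ?_
      filter_upwards [L.eventually_notMem_lattice hz] with w hw using hd w hw
    rw [← he z hz]
    exact h1.unique h2
  -- Squaring `2h(e - ℘) = ℘'` gives `4(x + d)(e - x)² = 4x³ - g₂x - g₃` at `x = ℘(z)`. The cubic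
  -- terms cancel, and identifying the rest gives the cubic a double root at `e`, so its
  -- discriminant vanishes.
  obtain ⟨h2, h1, h0⟩ := Polynomial.coeff_eq_zero_of_cubic_of_infinite
    (a := 4 * d - 8 * e) (b := 4 * e ^ 2 - 8 * d * e + L.g₂) (c := 4 * d * e ^ 2 + L.g₃)
    L.infinite_image_weierstrassP (by
      rintro _ ⟨z, hz, rfl⟩
      have h1 := L.derivWeierstrassP_sq z hz
      rw [← hprod z hz, mul_pow, mul_pow, hd z hz] at h1
      linear_combination h1)
  refine hΔ ?_
  have hd' : d = 2 * e := by linear_combination h2 / 4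
  subst hd'
  have hg2 : L.g₂ = 12 * e ^ 2 := by linear_combination h1
  have hg3 : L.g₃ = -8 * e ^ 3 := by linear_combination h0
  rw [hg2, hg3]
  ring

/-- An elliptic function whose only singularities are at most simple poles at lattice points has
residue zero. -/
theorem residue_eq_zero_of_simple_pole (hΔ : L.g₂ ^ 3 ≠ 27 * L.g₃ ^ 2) {h φ : ℂ → ℂ}
    (han : ∀ z ∉ L.lattice, AnalyticAt ℂ h z)
    (hper : ∀ z ∉ L.lattice, ∀ l ∈ L.lattice, h (z + l) = h z)
    (hφ : AnalyticAt ℂ φ 0) (hh : ∀ᶠ z in 𝓝[≠] 0, z * h z = φ z) : φ 0 = 0 := by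
  by_contra hc
  have hneg : AnalyticAt ℂ (fun z : ℂ ↦ -z) 0 := by fun_prop
  have hφ' : AnalyticAt ℂ (fun z ↦ φ (-z)) 0 := by
    have hφ0 : AnalyticAt ℂ φ (-0) := by simpa using hφ
    exact hφ0.comp hneg
  -- If the residue `φ 0` is nonzero, the odd part of `h` can be rescaled to have residue `1`.
  refine L.not_exists_odd_simple_pole hΔ (h := fun z ↦ (2 * φ 0)⁻¹ * (h z - h (-z)))
    (φ := fun z ↦ (2 * φ 0)⁻¹ * (φ z + φ (-z))) ?_ ?_ ?_ ?_ ?_ ?_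
  · intro z hz
    have h1 : AnalyticAt ℂ h (-z) := han _ (by simpa using hz)
    have h2 : AnalyticAt ℂ (fun w ↦ h (-w)) z := h1.comp (by fun_prop : AnalyticAt ℂ (-·) z)
    exact analyticAt_const.mul ((han z hz).sub h2)
  · intro z hz l hl
    have h1 := hper (-z) (by simpa using hz) (-l) (neg_mem hl)
    simp only [hper z hz l hl, neg_add, h1]
  · exact analyticAt_const.mul (hφ.add hφ')
  · have hh' : ∀ᶠ z in 𝓝[≠] (0 : ℂ), -z * h (-z) = φ (-z) := by
      have : Tendsto (fun z : ℂ ↦ -z) (𝓝[≠] 0) (𝓝[≠] 0) := by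
        refine tendsto_nhdsWithin_iff.mpr ⟨?_, ?_⟩
        · have : Tendsto (fun z : ℂ ↦ -z) (𝓝 0) (𝓝 (-0)) := tendsto_neg 0
          rw [neg_zero] at this
          exact this.mono_left nhdsWithin_le_nhds
        · filter_upwards [self_mem_nhdsWithin] with z hz
          simpa using hz
      exact this.eventually hh
    filter_upwards [hh, hh'] with z h1 h2
    linear_combination (2 * φ 0)⁻¹ * (h1 + h2)
  · exact .of_forall fun z ↦ by simp [add_comm]
  · simp only [neg_zero]
    field_simp
    norm_num

end PeriodPair

/-! ### Transformation under `SL(2, ℤ) ⋉ ℤ²`. -/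

namespace SingularJacobi

/-- The automorphy factor `cτ + d`. -/
noncomputable def autFactor (g : SL(2, ℤ)) (τ : ℍ) : ℂ := (g 1 0 : ℂ) * τ + g 1 1

lemma autFactor_eq_denom (g : SL(2, ℤ)) (τ : ℍ) : autFactor g τ = denom g τ := by
  simp [autFactor, denom]

lemma autFactor_ne_zero (g : SL(2, ℤ)) (τ : ℍ) : autFactor g τ ≠ 0 := by
  rw [autFactor_eq_denom]
  exact denom_ne_zero _ τ

lemma coe_smul_mul_autFactor (g : SL(2, ℤ)) (τ : ℍ) :
    ((g • τ : ℍ) : ℂ) * autFactor g τ = (g 0 0 : ℂ) * τ + g 0 1 := by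
  rw [specialLinearGroup_apply]
  exact div_mul_cancel₀ _ (by simpa [autFactor] using autFactor_ne_zero g τ)

lemma det_eq_one_cast (g : SL(2, ℤ)) :
    (g 0 0 : ℂ) * g 1 1 - (g 0 1 : ℂ) * g 1 0 = 1 := by
  have := g.det_coe
  rw [Matrix.det_fin_two] at this
  exact_mod_cast this

lemma mem_lattice_periods {τ : ℍ} {z : ℂ} :
    z ∈ (periods τ).lattice ↔ ∃ m n : ℤ, (m : ℂ) + n * τ = z := by
  simp [PeriodPair.mem_lattice, periods]

/-- Scaling by `cτ + d` sends the basis `1, gτ` to `cτ + d, aτ + b`, again a basis of `ℤ ⊕ τℤ` since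
`g` is unimodular. The transformation laws of `℘`, `∂_z ℘` and `Gₙ` follow by reindexing sums of
homogeneous terms. -/
lemma autFactor_mul_mem_lattice_iff (g : SL(2, ℤ)) (τ : ℍ) {z : ℂ} :
    autFactor g τ * z ∈ (periods τ).lattice ↔ z ∈ (periods (g • τ)).lattice := by
  have h1 := coe_smul_mul_autFactor g τ
  have hdet := det_eq_one_cast g
  have hj : autFactor g τ = (g 1 0 : ℂ) * τ + g 1 1 := rfl
  simp only [mem_lattice_periods]
  constructor
  · rintro ⟨m, n, h⟩
    refine ⟨m * g 0 0 - n * g 0 1, n * g 1 1 - m * g 1 0, ?_⟩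
    apply mul_left_cancel₀ (autFactor_ne_zero g τ)
    rw [← h]
    push_cast
    linear_combination (n * g 1 1 - m * g 1 0 : ℂ) * h1 + (m * g 0 0 - n * g 0 1 : ℂ) * hj +
      (m + n * τ : ℂ) * hdet
  · rintro ⟨m, n, rfl⟩
    refine ⟨m * g 1 1 + n * g 0 1, m * g 1 0 + n * g 0 0, ?_⟩
    push_cast
    linear_combination -(n : ℂ) * h1 - (m : ℂ) * hj

/-- Multiplication by `cτ + d` identifies the lattices of `gτ` and `τ`. -/
noncomputable def latticeEquiv (g : SL(2, ℤ)) (τ : ℍ) :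
    (periods (g • τ)).lattice ≃ (periods τ).lattice where
  toFun l := ⟨autFactor g τ * l, (autFactor_mul_mem_lattice_iff g τ).mpr l.2⟩
  invFun l := ⟨(autFactor g τ)⁻¹ * l, (autFactor_mul_mem_lattice_iff g τ).mp (by
    rw [mul_inv_cancel_left₀ (autFactor_ne_zero g τ)]; exact l.2)⟩
  left_inv l := by ext; simp [autFactor_ne_zero]
  right_inv l := by ext; simp [autFactor_ne_zero]

lemma coe_latticeEquiv (g : SL(2, ℤ)) (τ : ℍ) (l : (periods (g • τ)).lattice) :
    (latticeEquiv g τ l : ℂ) = autFactor g τ * l := rfl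

lemma weierstrassP_smul (g : SL(2, ℤ)) (τ : ℍ) (z : ℂ) :
    (periods (g • τ)).weierstrassP z =
      autFactor g τ ^ 2 * (periods τ).weierstrassP (autFactor g τ * z) := by
  rw [PeriodPair.weierstrassP, PeriodPair.weierstrassP, ← (latticeEquiv g τ).tsum_eq,
    ← tsum_mul_left]
  refine tsum_congr fun l ↦ ?_
  have := autFactor_ne_zero g τ
  rw [coe_latticeEquiv, ← mul_sub, mul_pow, mul_pow]
  simp only [one_div, mul_inv, mul_sub, mul_inv_cancel_left₀ (pow_ne_zero 2 this)]

lemma derivWeierstrassP_smul (g : SL(2, ℤ)) (τ : ℍ) (z : ℂ) :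
    (periods (g • τ)).derivWeierstrassP z =
      autFactor g τ ^ 3 * (periods τ).derivWeierstrassP (autFactor g τ * z) := by
  rw [PeriodPair.derivWeierstrassP, PeriodPair.derivWeierstrassP, ← (latticeEquiv g τ).tsum_eq,
    mul_neg, ← tsum_mul_left]
  refine congrArg Neg.neg (tsum_congr fun l ↦ ?_)
  have := autFactor_ne_zero g τ
  rw [coe_latticeEquiv, ← mul_sub, mul_pow]
  field_simp

lemma G_smul (g : SL(2, ℤ)) (τ : ℍ) (n : ℕ) :
    (periods (g • τ)).G n = autFactor g τ ^ n * (periods τ).G n := by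
  rw [PeriodPair.G, PeriodPair.G, ← (latticeEquiv g τ).tsum_eq, ← tsum_mul_left]
  refine tsum_congr fun l ↦ ?_
  rw [coe_latticeEquiv, mul_pow, mul_inv,
    mul_inv_cancel_left₀ (pow_ne_zero n (autFactor_ne_zero g τ))]

lemma translate_mem_lattice (τ : ℍ) (l μ : ℤ) : (l * τ + μ : ℂ) ∈ (periods τ).lattice :=
  mem_lattice_periods.mpr ⟨μ, l, by ring⟩

lemma translate_div_mem_lattice_iff (g : SL(2, ℤ)) (l μ : ℤ) (τ : ℍ) (z : ℂ) :
    (z + l * τ + μ) / autFactor g τ ∈ (periods (g • τ)).lattice ↔ z ∈ (periods τ).lattice := by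
  rw [← autFactor_mul_mem_lattice_iff, mul_div_cancel₀ _ (autFactor_ne_zero g τ), add_assoc]
  exact (periods τ).add_mem_lattice_iff (translate_mem_lattice τ l μ)

lemma ext_of_notMem (f : Fun) {τ : ℍ} {z : ℂ} (h : z ∉ (periods τ).lattice) :
    f.ext τ z = f ⟨(τ, z), h⟩ := dif_pos h

lemma ext_of_mem (f : Fun) {τ : ℍ} {z : ℂ} (h : z ∈ (periods τ).lattice) :
    f.ext τ z = 0 := dif_neg (not_not.mpr h)

lemma slash_zero_apply (k : ℕ) (g : SL(2, ℤ)) (l μ : ℤ) (F : ℍ → ℂ → ℂ) (τ : ℍ) (z : ℂ) :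
    slash k 0 g l μ F τ z =
      (autFactor g τ ^ k)⁻¹ * F (g • τ) ((z + l * τ + μ) / autFactor g τ) := by
  simp [slash, autFactor]

/-- Invariance of weight `k` and index `0`, in terms of values off the lattice. -/
lemma slash_ext_eq_iff (k : ℕ) (f : Fun) :
    (∀ (g : SL(2, ℤ)) (l μ : ℤ), slash k 0 g l μ f.ext = f.ext) ↔
    ∀ (g : SL(2, ℤ)) (l μ : ℤ) (τ : ℍ) (z : ℂ), z ∉ (periods τ).lattice →
      f.ext (g • τ) ((z + l * τ + μ) / autFactor g τ) = autFactor g τ ^ k * f.ext τ z := by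
  have key (g : SL(2, ℤ)) (l μ : ℤ) (τ : ℍ) (z : ℂ) : slash k 0 g l μ f.ext τ z = f.ext τ z ↔
      f.ext (g • τ) ((z + l * τ + μ) / autFactor g τ) = autFactor g τ ^ k * f.ext τ z := by
    rw [slash_zero_apply, inv_mul_eq_iff_eq_mul₀ (pow_ne_zero k (autFactor_ne_zero g τ))]
  constructor
  · exact fun h g l μ τ z _ ↦ (key g l μ τ z).mp (congrFun₂ (h g l μ) τ z)
  · intro h g l μ
    ext τ z
    rw [key]
    by_cases hz : z ∈ (periods τ).lattice
    · rw [ext_of_mem _ hz, ext_of_mem _ ((translate_div_mem_lattice_iff g l μ τ z).mpr hz), mul_zero]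
    · exact h g l μ τ z hz

lemma wp_apply (p : Dom) : wp p = (periods p.1.1).weierstrassP p.1.2 := rfl

lemma dwp_apply (p : Dom) : dwp p = (periods p.1.1).derivWeierstrassP p.1.2 := by
  simp [dwp]

lemma e4_apply (p : Dom) : e4 p = (periods p.1.1).G 4 := rfl

/-- The functions invariant of weight `k` and index `0`. -/
def Invariant (k : ℕ) : Submodule ℂ Fun where
  carrier := {f | ∀ (g : SL(2, ℤ)) (l μ : ℤ) (τ : ℍ) (z : ℂ), z ∉ (periods τ).lattice →
      f.ext (g • τ) ((z + l * τ + μ) / autFactor g τ) = autFactor g τ ^ k * f.ext τ z}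
  zero_mem' g l μ τ z hz := by
    have hz' := (translate_div_mem_lattice_iff g l μ τ z).not.mpr hz
    rw [ext_of_notMem _ hz, ext_of_notMem _ hz']
    simp
  add_mem' {f₁ f₂} h₁ h₂ g l μ τ z hz := by
    have hz' := (translate_div_mem_lattice_iff g l μ τ z).not.mpr hz
    have h₁ := h₁ g l μ τ z hz
    have h₂ := h₂ g l μ τ z hz
    simp only [ext_of_notMem _ hz, ext_of_notMem _ hz', Pi.add_apply] at *
    rw [h₁, h₂, mul_add]
  smul_mem' c f h g l μ τ z hz := by
    have hz' := (translate_div_mem_lattice_iff g l μ τ z).not.mpr hz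
    have h := h g l μ τ z hz
    simp only [ext_of_notMem _ hz, ext_of_notMem _ hz', Pi.smul_apply, smul_eq_mul] at *
    rw [h, mul_left_comm]

lemma mem_invariant_iff {k : ℕ} {f : Fun} : f ∈ Invariant k ↔
    ∀ (g : SL(2, ℤ)) (l μ : ℤ), slash k 0 g l μ f.ext = f.ext :=
  (slash_ext_eq_iff k f).symm

instance : SetLike.GradedMonoid Invariant where
  one_mem g l μ τ z hz := by
    have hz' := (translate_div_mem_lattice_iff g l μ τ z).not.mpr hz
    rw [ext_of_notMem _ hz, ext_of_notMem _ hz']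
    simp
  mul_mem k₁ k₂ f₁ f₂ h₁ h₂ g l μ τ z hz := by
    have hz' := (translate_div_mem_lattice_iff g l μ τ z).not.mpr hz
    have h₁ := h₁ g l μ τ z hz
    have h₂ := h₂ g l μ τ z hz
    simp only [ext_of_notMem _ hz, ext_of_notMem _ hz', Pi.mul_apply] at *
    rw [h₁, h₂, pow_add]
    ring

lemma wp_mem_invariant : wp ∈ Invariant 2 := by
  intro g l μ τ z hz
  have hz' := (translate_div_mem_lattice_iff g l μ τ z).not.mpr hz
  rw [ext_of_notMem _ hz, ext_of_notMem _ hz', wp_apply, wp_apply]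
  simp only
  rw [weierstrassP_smul, mul_div_cancel₀ _ (autFactor_ne_zero g τ), add_assoc,
    (periods τ).weierstrassP_add_coe z ⟨_, translate_mem_lattice τ l μ⟩]

lemma dwp_mem_invariant : dwp ∈ Invariant 3 := by
  intro g l μ τ z hz
  have hz' := (translate_div_mem_lattice_iff g l μ τ z).not.mpr hz
  rw [ext_of_notMem _ hz, ext_of_notMem _ hz', dwp_apply, dwp_apply]
  simp only
  rw [derivWeierstrassP_smul, mul_div_cancel₀ _ (autFactor_ne_zero g τ), add_assoc,
    (periods τ).derivWeierstrassP_add_coe z ⟨_, translate_mem_lattice τ l μ⟩]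

/-- A function of `τ`, regarded as a function of `(τ, z)`. -/
noncomputable def pullback : (ℍ → ℂ) →ₐ[ℂ] Fun where
  toFun F p := F p.1.1
  map_one' := rfl
  map_mul' _ _ := rfl
  map_zero' := rfl
  map_add' _ _ := rfl
  commutes' _ := rfl

lemma pullback_apply (F : ℍ → ℂ) (p : Dom) : pullback F p = F p.1.1 := rfl

lemma pullback_mem_invariant {k : ℕ} {F : ℍ → ℂ}
    (hF : ∀ (g : SL(2, ℤ)) (τ : ℍ), F (g • τ) = autFactor g τ ^ k * F τ) :
    pullback F ∈ Invariant k := by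
  intro g l μ τ z hz
  have hz' := (translate_div_mem_lattice_iff g l μ τ z).not.mpr hz
  rw [ext_of_notMem _ hz, ext_of_notMem _ hz', pullback_apply, pullback_apply, hF]

/-- The Eisenstein function `∑ w⁻ⁿ`, as a function on the upper half-plane. -/
noncomputable def eis (n : ℕ) (τ : ℍ) : ℂ := (periods τ).G n

lemma eis_smul (n : ℕ) (g : SL(2, ℤ)) (τ : ℍ) : eis n (g • τ) = autFactor g τ ^ n * eis n τ :=
  G_smul g τ n

lemma pullback_eis_four : pullback (eis 4) = e4 := rfl

end SingularJacobi

/-! ### Level-one modular forms as polynomials in `G₄` and `G₆`. -/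

namespace SingularJacobi

open ModularForm EisensteinSeries

/-- The pairs of integers index the lattice `ℤ ⊕ τℤ`. -/
noncomputable def latticeIndexEquiv (τ : ℍ) : (Fin 2 → ℤ) ≃ (periods τ).lattice :=
  (finTwoArrowEquiv ℤ).trans ((Equiv.prodComm ℤ ℤ).trans
    (periods τ).latticeEquivProd.symm.toEquiv)

lemma coe_latticeIndexEquiv (τ : ℍ) (v : Fin 2 → ℤ) :
    (latticeIndexEquiv τ v : ℂ) = v 0 * τ + v 1 := by
  have := (periods τ).latticeEquiv_symm_apply (v 1, v 0)
  simp only [periods, mul_one] at this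
  rw [add_comm]
  exact this

/-- Extracting gcds writes the lattice sum as `ζ(n)` times the sum over coprime pairs; `E` is half
of the latter. -/
lemma eis_eq_mul_E {n : ℕ} (hn : 3 ≤ n) (τ : ℍ) :
    eis n τ = 2 * riemannZeta n * E hn τ := by
  have h1 := tsum_eisSummand_eq_riemannZeta_mul_eisensteinSeries hn τ
  have h2 : E hn τ = (1 / 2 : ℂ) * eisensteinSeries (N := 1) 0 n τ := rfl
  rw [eis, PeriodPair.G, ← (latticeIndexEquiv τ).tsum_eq, h2]
  simp_rw [coe_latticeIndexEquiv]
  simp only [eisSummand, zpow_neg, zpow_natCast] at h1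
  rw [h1]
  ring

lemma riemannZeta_six : riemannZeta 6 = (Real.pi : ℂ) ^ 6 / 945 := by
  have := riemannZeta_two_mul_nat (k := 3) (by norm_num)
  norm_num [show bernoulli 6 = 1 / 42 by decide +kernel, Nat.factorial] at this
  rw [this]
  ring

lemma eis_four_eq (τ : ℍ) : eis 4 τ = (Real.pi : ℂ) ^ 4 / 45 * E₄ τ := by
  rw [eis_eq_mul_E (by norm_num : 3 ≤ 4)]
  norm_num [riemannZeta_four]
  exact Or.inl (by ring)

lemma eis_six_eq (τ : ℍ) : eis 6 τ = 2 * (Real.pi : ℂ) ^ 6 / 945 * E₆ τ := by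
  rw [eis_eq_mul_E (by norm_num : 3 ≤ 6)]
  norm_num [riemannZeta_six]
  exact Or.inl (by ring)

lemma pi_ne_zero_complex : (Real.pi : ℂ) ≠ 0 := by exact_mod_cast Real.pi_ne_zero

lemma E₄_cube_ne_E₆_sq (τ : ℍ) : E₄ τ ^ 3 ≠ E₆ τ ^ 2 := by
  intro h
  apply discriminant_ne_zero τ
  rw [discriminant_eq_E₄_cube_sub_E₆_sq, h]
  simp

/-- Since `g₂ = (4/3)π⁴E₄` and `g₃ = (8/27)π⁶E₆`, this is the nonvanishing of the modular
discriminant, which the residue theorem needs at every `τ`. -/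
lemma g₂_cube_ne (τ : ℍ) : (periods τ).g₂ ^ 3 ≠ 27 * (periods τ).g₃ ^ 2 := by
  have h4 : (periods τ).g₂ = 60 * eis 4 τ := rfl
  have h6 : (periods τ).g₃ = 140 * eis 6 τ := rfl
  rw [h4, h6, eis_four_eq, eis_six_eq]
  intro h
  apply E₄_cube_ne_E₆_sq τ
  have hpi : (Real.pi : ℂ) ^ 12 ≠ 0 := pow_ne_zero _ pi_ne_zero_complex
  apply mul_left_cancel₀ hpi
  linear_combination (27 / 64 : ℂ) * h

/-- The span of the monomials of weight `k` in the Eisenstein functions of weights `4` and `6`. -/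
noncomputable def eisSpan (k : ℕ) : Submodule ℂ (ℍ → ℂ) :=
  Submodule.span ℂ {F | ∃ a b : ℕ, 4 * a + 6 * b = k ∧ F = eis 4 ^ a * eis 6 ^ b}

lemma monomial_mem_eisSpan (a b : ℕ) : eis 4 ^ a * eis 6 ^ b ∈ eisSpan (4 * a + 6 * b) :=
  Submodule.subset_span ⟨a, b, rfl, rfl⟩

lemma mul_mem_eisSpan {k l : ℕ} {F G : ℍ → ℂ} (hF : F ∈ eisSpan k) (hG : G ∈ eisSpan l) :
    F * G ∈ eisSpan (k + l) := by
  have h := Submodule.mul_mem_mul hF hG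
  rw [eisSpan, eisSpan, Submodule.span_mul_span] at h
  refine Submodule.span_mono ?_ h
  rintro _ ⟨_, ⟨a, b, rfl, rfl⟩, _, ⟨c, d, rfl, rfl⟩, rfl⟩
  exact ⟨a + c, b + d, by ring, by ring⟩

lemma E₄_eq : (E₄ : ℍ → ℂ) = (45 / (Real.pi : ℂ) ^ 4) • eis 4 := by
  ext τ
  have := pi_ne_zero_complex
  rw [Pi.smul_apply, eis_four_eq, smul_eq_mul]
  field_simp

lemma E₆_eq : (E₆ : ℍ → ℂ) = (945 / (2 * (Real.pi : ℂ) ^ 6)) • eis 6 := by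
  ext τ
  have := pi_ne_zero_complex
  rw [Pi.smul_apply, eis_six_eq, smul_eq_mul]
  field_simp

lemma E_monomial_mem_eisSpan {a b k : ℕ} (h : 4 * a + 6 * b = k) :
    (E₄ : ℍ → ℂ) ^ a * (E₆ : ℍ → ℂ) ^ b ∈ eisSpan k := by
  subst h
  rw [E₄_eq, E₆_eq, smul_pow, smul_pow, smul_mul_smul_comm]
  exact Submodule.smul_mem _ _ (monomial_mem_eisSpan a b)

lemma discriminant_mem_eisSpan : discriminant ∈ eisSpan 12 := by
  have h : discriminant = (1 / 1728 : ℂ) •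
      ((E₄ : ℍ → ℂ) ^ 3 * (E₆ : ℍ → ℂ) ^ 0 - (E₄ : ℍ → ℂ) ^ 0 * (E₆ : ℍ → ℂ) ^ 2) := by
    ext τ
    rw [discriminant_eq_E₄_cube_sub_E₆_sq]
    simp
    ring
  rw [h]
  exact Submodule.smul_mem _ _ (Submodule.sub_mem _ (E_monomial_mem_eisSpan rfl)
    (E_monomial_mem_eisSpan rfl))

lemma exists_monomial_modularForm {a b k : ℕ} (h : 4 * a + 6 * b = k) :
    ∃ H : ModularForm 𝒮ℒ k, (H : ℍ → ℂ) = (E₄ : ℍ → ℂ) ^ a * (E₆ : ℍ → ℂ) ^ b ∧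
      (qExpansion 1 H).coeff 0 = 1 := by
  have hk : (a : ℤ) * 4 + b * 6 = k := by rw [← h]; push_cast; ring
  refine ⟨ModularForm.mcast hk ((E₄.pow a).mul (E₆.pow b)), ?_, ?_⟩
  · ext τ
    simp
  · rw [ModularForm.coe_mcast,
      ModularForm.qExpansion_mul one_pos one_mem_strictPeriods_SL,
      ModularForm.qExpansion_pow one_pos one_mem_strictPeriods_SL,
      ModularForm.qExpansion_pow one_pos one_mem_strictPeriods_SL]
    have h4 := E_qExpansion_coeff_zero (by norm_num : 3 ≤ 4) ⟨2, rfl⟩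
    have h6 := E_qExpansion_coeff_zero (by norm_num : 3 ≤ 6) ⟨3, rfl⟩
    rw [PowerSeries.coeff_zero_eq_constantCoeff_apply] at h4 h6 ⊢
    rw [map_mul, map_pow, map_pow, h4, h6, one_pow, one_pow, one_mul]

/-- Modular forms of level one are polynomials in the Eisenstein functions. -/
theorem modularForm_mem_eisSpan (k : ℕ) (F : ModularForm 𝒮ℒ k) : (F : ℍ → ℂ) ∈ eisSpan k := by
  induction k using Nat.strong_induction_on with | _ k ih =>
  rcases Nat.even_or_odd k with hk | hk
  swap
  · rw [ModularForm.levelOne_odd_weight_eq_zero (by exact_mod_cast hk) F]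
    exact Submodule.zero_mem _
  obtain rfl | rfl | hk4 : k = 0 ∨ k = 2 ∨ 4 ≤ k := by
    obtain ⟨m, rfl⟩ := hk
    omega
  · obtain ⟨c, hc⟩ := ModularFormClass.levelOne_weight_zero_const F
    have h : (F : ℍ → ℂ) = c • (eis 4 ^ 0 * eis 6 ^ 0) := by
      rw [hc]
      ext
      simp
    rw [h]
    exact Submodule.smul_mem _ _ (monomial_mem_eisSpan 0 0)
  · rw [rank_zero_iff_forall_zero.mp levelOne_weight_two_rank_zero F]
    exact Submodule.zero_mem _
  obtain ⟨a, b, hab⟩ : ∃ a b : ℕ, 4 * a + 6 * b = k := by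
    obtain ⟨m, rfl⟩ := hk
    rcases Nat.even_or_odd m with ⟨n, rfl⟩ | ⟨n, rfl⟩
    · exact ⟨n, 0, by ring⟩
    -- Here `k = 4n + 2 ≥ 4`, so `n ≥ 1` and the subtraction is not truncated.
    · exact ⟨n - 1, 1, by omega⟩
  obtain ⟨H, hH, hH0⟩ := exists_monomial_modularForm hab
  set c := (qExpansion 1 F).coeff 0
  have h0 : (qExpansion 1 ((F - c • H : ModularForm 𝒮ℒ k) : ℍ → ℂ)).coeff 0 = 0 := by
    rw [FunLike.coe_sub, ModularForm.qExpansion_sub one_pos one_mem_strictPeriods_SL,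
      FunLike.coe_smul, ModularForm.qExpansion_smul one_pos one_mem_strictPeriods_SL,
      map_sub, PowerSeries.coeff_smul, hH0]
    simp [c]
  -- Removing the constant term leaves a cusp form, hence `Δ` times a form of weight `k - 12`, to
  -- which induction applies unless that weight is negative.
  set F' := CuspForm.discriminantEquiv (toCuspForm (F - c • H) h0) with hF'
  have hmul : (F : ℍ → ℂ) = c • (H : ℍ → ℂ) + discriminant * (F' : ℍ → ℂ) := by
    ext τ
    have := discriminant_mul_discriminantEquiv_apply (toCuspForm (F - c • H) h0) τ
    rw [toCuspForm_apply] at this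
    simp only [Pi.add_apply, Pi.smul_apply, Pi.mul_apply, hF', this]
    simp
  rw [hmul]
  refine Submodule.add_mem _ (Submodule.smul_mem _ _ (hH ▸ E_monomial_mem_eisSpan hab)) ?_
  rcases lt_or_ge k 12 with hk12 | hk12
  · rw [rank_zero_iff_forall_zero.mp (levelOne_neg_weight_rank_zero (by omega)) F',
      FunLike.coe_zero, mul_zero]
    exact Submodule.zero_mem _
  · have hk' : (k : ℤ) - 12 = ((k - 12 : ℕ) : ℤ) := by omega
    have h := mul_mem_eisSpan discriminant_mem_eisSpan
      (ih (k - 12) (by omega) (ModularForm.mcast hk' F'))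
    rwa [ModularForm.coe_mcast, Nat.add_sub_cancel' hk12] at h

/-- A holomorphic function on the upper half-plane which is bounded at infinity and transforms with
weight `k` is a modular form. -/
theorem exists_modularForm {k : ℤ} {A : ℍ → ℂ} (hA : MDifferentiable 𝓘(ℂ) 𝓘(ℂ) A)
    (hbdd : IsBoundedAtImInfty A)
    (hslash : ∀ (g : SL(2, ℤ)) (τ : ℍ), A (g • τ) = autFactor g τ ^ k * A τ) :
    ∃ F : ModularForm 𝒮ℒ k, (F : ℍ → ℂ) = A := by
  have hs (g : SL(2, ℤ)) : A ∣[k] g = A := by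
    ext τ
    rw [ModularForm.SL_slash_apply, hslash, autFactor_eq_denom, mul_right_comm, zpow_neg,
      mul_inv_cancel₀ (zpow_ne_zero _ (denom_ne_zero _ τ)), one_mul]
  refine ⟨{ toFun := A
            slash_action_eq' := ?_
            holo' := hA
            bdd_at_cusps' := ?_ }, rfl⟩
  · rintro _ ⟨g, rfl⟩
    exact hs g
  · intro c hc
    -- Every cusp is a translate of `∞`, so invariance carries the bound at `∞` to all of them.
    rw [Subgroup.IsArithmetic.isCusp_iff_isCusp_SL2Z] at hc
    rw [OnePoint.isBoundedAt_iff_forall_SL2Z hc]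
    intro g _
    rw [hs g]
    exact hbdd

end SingularJacobi

/-! ### Expansions at `z = 0` with coefficients holomorphic at infinity. -/

namespace SingularJacobi

open Filter

/-- The `1`-periodic holomorphic functions on the upper half-plane which are bounded at infinity. -/
def holomorphicAtInfty : Subalgebra ℂ (ℍ → ℂ) where
  carrier := {A | MDifferentiable 𝓘(ℂ) 𝓘(ℂ) A ∧ IsBoundedAtImInfty A ∧
    ∀ τ : ℍ, A ((1 : ℝ) +ᵥ τ) = A τ}
  mul_mem' {A B} hA hB := ⟨hA.1.mul hB.1, hA.2.1.mul hB.2.1, fun τ ↦ by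
    simp [hA.2.2 τ, hB.2.2 τ]⟩
  add_mem' {A B} hA hB := ⟨hA.1.add hB.1, hA.2.1.add hB.2.1, fun τ ↦ by
    simp [hA.2.2 τ, hB.2.2 τ]⟩
  algebraMap_mem' c := ⟨fun _ ↦ mdifferentiableAt_const, const_boundedAtFilter _ c, fun _ ↦ rfl⟩

lemma qParam_one_pow (τ : ℍ) (r : ℕ) :
    Function.Periodic.qParam 1 τ ^ r = Complex.exp (2 * Real.pi * Complex.I * r * τ) := by
  rw [Function.Periodic.qParam, ← Complex.exp_nat_mul]
  congr 1
  push_cast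
  ring

/-- Boundedness and periodicity are visibly stable under products; this lemma and its converse below
exchange them for Fourier expansions. -/
lemma hasFourierExpansion_of_mem {A : ℍ → ℂ} (hA : A ∈ holomorphicAtInfty) :
    HasFourierExpansion A := by
  obtain ⟨hd, hb, hp⟩ := hA
  have hper : Function.Periodic (A ∘ ofComplex) ((1 : ℝ) : ℂ) := by
    intro w
    by_cases! hw : 0 < w.im
    · have hw' : 0 < (w + ((1 : ℝ) : ℂ)).im := by simpa using hw
      simp only [Function.comp_apply, ofComplex_apply_of_im_pos hw', ofComplex_apply_of_im_pos hw]
      rw [← hp ⟨w, hw⟩]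
      congr 1
      ext
      simp [add_comm]
    -- Off the upper half-plane `ofComplex` takes one default value, so periodicity is trivial
    -- there.
    · have hw' : (w + ((1 : ℝ) : ℂ)).im ≤ 0 := by simpa using hw
      simp only [Function.comp_apply, ofComplex_apply_of_im_nonpos hw',
        ofComplex_apply_of_im_nonpos hw]
  refine ⟨fun r ↦ (qExpansion 1 A).coeff r, fun τ ↦ ?_⟩
  simpa [qParam_one_pow] using hasSum_qExpansion one_pos hper hd hb τ

lemma mem_holomorphicAtInfty_of_hasFourierExpansion {A : ℍ → ℂ}
    (hA : MDifferentiable 𝓘(ℂ) 𝓘(ℂ) A) (hF : HasFourierExpansion A) :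
    A ∈ holomorphicAtInfty := by
  obtain ⟨c, hc⟩ := hF
  refine ⟨hA, isBoundedAtImInfty_of_hasSum_qExpansion (h := 1) (c := c) one_pos fun τ ↦ by
    simpa [qParam_one_pow] using hc τ, fun τ ↦ ?_⟩
  have h := hc ((1 : ℝ) +ᵥ τ)
  refine (h.congr_fun ?_).unique (hc τ)
  intro r
  congr 1
  rw [Complex.exp_eq_exp_iff_exists_int]
  refine ⟨-r, ?_⟩
  simp
  ring

lemma modularForm_mem_holomorphicAtInfty {k : ℤ} (F : ModularForm 𝒮ℒ k) :
    (F : ℍ → ℂ) ∈ holomorphicAtInfty :=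
  ⟨F.holo', ModularFormClass.bdd_at_infty F, fun τ ↦ by
    simpa using SlashInvariantForm.vAdd_apply_of_mem_strictPeriods F τ one_mem_strictPeriods_SL⟩

lemma eis_mem_holomorphicAtInfty {n : ℕ} (hn : 3 ≤ n) : eis n ∈ holomorphicAtInfty := by
  have h : eis n = (2 * riemannZeta n) • (ModularForm.E hn : ℍ → ℂ) := by
    ext τ
    rw [eis_eq_mul_E hn]
    rfl
  rw [h]
  exact Subalgebra.smul_mem _ (modularForm_mem_holomorphicAtInfty _) _

/-- The families, indexed by `τ`, of germs at `0` of analytic functions whose Taylor coefficients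
are holomorphic in `τ` on the upper half-plane and at infinity. -/
def analyticFamily : Subalgebra ℂ (ℍ → ℂ → ℂ) where
  carrier := {φ | (∀ τ, AnalyticAt ℂ (φ τ) 0) ∧
    ∀ n, (fun τ ↦ iteratedDeriv n (φ τ) 0) ∈ holomorphicAtInfty}
  mul_mem' {φ ψ} hφ hψ := by
    refine ⟨fun τ ↦ (hφ.1 τ).mul (hψ.1 τ), fun n ↦ ?_⟩
    have h : (fun τ ↦ iteratedDeriv n ((φ * ψ) τ) 0) = ∑ i ∈ Finset.range (n + 1),
        (n.choose i : ℂ) • ((fun τ ↦ iteratedDeriv i (φ τ) 0) *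
          fun τ ↦ iteratedDeriv (n - i) (ψ τ) 0) := by
      ext τ
      rw [Pi.mul_apply, iteratedDeriv_mul (hφ.1 τ).contDiffAt (hψ.1 τ).contDiffAt]
      simp [mul_assoc]
    rw [h]
    exact Subalgebra.sum_mem _ fun i _ ↦
      Subalgebra.smul_mem _ (Subalgebra.mul_mem _ (hφ.2 i) (hψ.2 (n - i))) _
  add_mem' {φ ψ} hφ hψ := by
    refine ⟨fun τ ↦ (hφ.1 τ).add (hψ.1 τ), fun n ↦ ?_⟩
    have h : (fun τ ↦ iteratedDeriv n ((φ + ψ) τ) 0) =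
        (fun τ ↦ iteratedDeriv n (φ τ) 0) + fun τ ↦ iteratedDeriv n (ψ τ) 0 := by
      ext τ
      rw [Pi.add_apply, iteratedDeriv_add (hφ.1 τ).contDiffAt (hψ.1 τ).contDiffAt]
      rfl
    rw [h]
    exact Subalgebra.add_mem _ (hφ.2 n) (hψ.2 n)
  algebraMap_mem' c := by
    refine ⟨fun τ ↦ analyticAt_const, fun n ↦ ?_⟩
    have h : (fun τ : ℍ ↦ iteratedDeriv n (algebraMap ℂ (ℍ → ℂ → ℂ) c τ) 0) =
        algebraMap ℂ (ℍ → ℂ) (if n = 0 then c else 0) := by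
      ext τ
      exact iteratedDeriv_const
    rw [h]
    exact Subalgebra.algebraMap_mem _ _

lemma const_mem_analyticFamily {A : ℍ → ℂ} (hA : A ∈ holomorphicAtInfty) :
    (fun τ _ ↦ A τ) ∈ analyticFamily := by
  refine ⟨fun τ ↦ analyticAt_const, fun n ↦ ?_⟩
  simp only [iteratedDeriv_const]
  split_ifs
  · exact hA
  · exact Subalgebra.zero_mem _

lemma id_mem_analyticFamily : (fun _ z ↦ z : ℍ → ℂ → ℂ) ∈ analyticFamily := by
  refine ⟨fun τ ↦ analyticAt_id, fun n ↦ ?_⟩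
  exact Subalgebra.algebraMap_mem _ (iteratedDeriv n (fun z : ℂ ↦ z) 0)

/-- The Taylor coefficients are multiples of `Gₙ₊₂`. The constant term vanishes thanks to the
subtracted `w⁻²`, so the weight `2` sum never enters. -/
lemma weierstrassPExcept_mem_analyticFamily :
    (fun τ ↦ (periods τ).weierstrassPExcept 0) ∈ analyticFamily := by
  refine ⟨fun τ ↦ (periods τ).analyticAt_weierstrassPExcept 0, fun n ↦ ?_⟩
  simp only [PeriodPair.iteratedDeriv_weierstrassPExcept_self,
    PeriodPair.weierstrassPExcept_zero, PeriodPair.sumInvPow_zero]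
  split_ifs with hn
  · exact Subalgebra.zero_mem _
  · exact Subalgebra.smul_mem _ (eis_mem_holomorphicAtInfty (n := n + 2) (by omega)) _

lemma derivWeierstrassPExcept_mem_analyticFamily :
    (fun τ ↦ (periods τ).derivWeierstrassPExcept 0) ∈ analyticFamily := by
  refine ⟨fun τ ↦ (periods τ).analyticAt_derivWeierstrassPExcept 0, fun n ↦ ?_⟩
  simp only [PeriodPair.iteratedDeriv_derivWeierstrassPExcept_self, PeriodPair.sumInvPow_zero]
  exact Subalgebra.smul_mem _ (eis_mem_holomorphicAtInfty (n := n + 3) (by omega)) _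

/-- `φ` is the family of expansions at `z = 0` of the functions `z ^ N * f(τ, z)`. -/
structure HasExpansion (f : Fun) (N : ℕ) (φ : ℍ → ℂ → ℂ) : Prop where
  analyticAt : ∀ (τ : ℍ) (z : ℂ), z ∉ (periods τ).lattice → AnalyticAt ℂ (f.ext τ) z
  mem : φ ∈ analyticFamily
  eventually_eq : ∀ τ, ∀ᶠ z in 𝓝[≠] 0, z ^ N * f.ext τ z = φ τ z

lemma ext_add (f₁ f₂ : Fun) (τ : ℍ) : (f₁ + f₂).ext τ = f₁.ext τ + f₂.ext τ := by
  ext z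
  by_cases hz : z ∈ (periods τ).lattice
  · simp [ext_of_mem _ hz]
  · simp [ext_of_notMem _ hz]

lemma ext_mul (f₁ f₂ : Fun) (τ : ℍ) : (f₁ * f₂).ext τ = f₁.ext τ * f₂.ext τ := by
  ext z
  by_cases hz : z ∈ (periods τ).lattice
  · simp [ext_of_mem _ hz]
  · simp [ext_of_notMem _ hz]

lemma HasExpansion.add {f₁ f₂ : Fun} {N : ℕ} {φ₁ φ₂ : ℍ → ℂ → ℂ} (h₁ : HasExpansion f₁ N φ₁)
    (h₂ : HasExpansion f₂ N φ₂) : HasExpansion (f₁ + f₂) N (φ₁ + φ₂) where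
  analyticAt τ z hz := ext_add f₁ f₂ τ ▸ (h₁.analyticAt τ z hz).add (h₂.analyticAt τ z hz)
  mem := Subalgebra.add_mem _ h₁.mem h₂.mem
  eventually_eq τ := by
    filter_upwards [h₁.eventually_eq τ, h₂.eventually_eq τ] with z hz₁ hz₂
    rw [ext_add, Pi.add_apply, mul_add, hz₁, hz₂]
    rfl

lemma HasExpansion.mul {f₁ f₂ : Fun} {N₁ N₂ : ℕ} {φ₁ φ₂ : ℍ → ℂ → ℂ}
    (h₁ : HasExpansion f₁ N₁ φ₁) (h₂ : HasExpansion f₂ N₂ φ₂) :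
    HasExpansion (f₁ * f₂) (N₁ + N₂) (φ₁ * φ₂) where
  analyticAt τ z hz := ext_mul f₁ f₂ τ ▸ (h₁.analyticAt τ z hz).mul (h₂.analyticAt τ z hz)
  mem := Subalgebra.mul_mem _ h₁.mem h₂.mem
  eventually_eq τ := by
    filter_upwards [h₁.eventually_eq τ, h₂.eventually_eq τ] with z hz₁ hz₂
    rw [ext_mul, Pi.mul_apply, pow_add, mul_mul_mul_comm, hz₁, hz₂]
    rfl

/-- `N` only bounds the pole order; raising it brings two expansions to a common exponent before
adding. -/
lemma HasExpansion.mono {f : Fun} {N M : ℕ} {φ : ℍ → ℂ → ℂ} (h : HasExpansion f N φ) :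
    HasExpansion f (M + N) ((fun _ z ↦ z) ^ M * φ) where
  analyticAt := h.analyticAt
  mem := Subalgebra.mul_mem _ (Subalgebra.pow_mem _ id_mem_analyticFamily M) h.mem
  eventually_eq τ := by
    filter_upwards [h.eventually_eq τ] with z hz
    rw [pow_add, mul_assoc, hz]
    rfl

lemma hasExpansion_pullback {A : ℍ → ℂ} (hA : A ∈ holomorphicAtInfty) :
    HasExpansion (pullback A) 0 (fun τ _ ↦ A τ) where
  analyticAt τ z hz := by
    refine (analyticAt_const (v := A τ)).congr ?_
    filter_upwards [(periods τ).eventually_notMem_lattice hz] with w hw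
    rw [ext_of_notMem _ hw, pullback_apply]
  mem := const_mem_analyticFamily hA
  eventually_eq τ := by
    filter_upwards [(periods τ).eventually_nhdsNE_zero_notMem_lattice] with z hz
    rw [ext_of_notMem _ hz, pullback_apply, pow_zero, one_mul]

lemma hasExpansion_one : HasExpansion 1 0 1 :=
  hasExpansion_pullback (Subalgebra.one_mem holomorphicAtInfty)

lemma HasExpansion.pow {f : Fun} {N : ℕ} {φ : ℍ → ℂ → ℂ} (h : HasExpansion f N φ) (a : ℕ) :
    HasExpansion (f ^ a) (N * a) (φ ^ a) := by
  induction a with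
  | zero => simpa using hasExpansion_one
  | succ a ih => simpa [pow_succ, Nat.mul_succ] using ih.mul h

lemma HasExpansion.smul {f : Fun} {N : ℕ} {φ : ℍ → ℂ → ℂ} (h : HasExpansion f N φ) (c : ℂ) :
    HasExpansion (c • f) N (c • φ) := by
  have h1 := (hasExpansion_pullback (Subalgebra.algebraMap_mem holomorphicAtInfty c)).mul h
  rw [zero_add] at h1
  exact h1

lemma hasExpansion_wp :
    HasExpansion wp 2 ((fun _ z ↦ z) ^ 2 * (fun τ ↦ (periods τ).weierstrassPExcept 0) + 1) where
  analyticAt τ z hz := by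
    refine ((periods τ).analyticOnNhd_weierstrassP z hz).congr ?_
    filter_upwards [(periods τ).eventually_notMem_lattice hz] with w hw
    rw [ext_of_notMem _ hw, wp_apply]
  mem := Subalgebra.add_mem _ (Subalgebra.mul_mem _ (Subalgebra.pow_mem _ id_mem_analyticFamily 2)
    weierstrassPExcept_mem_analyticFamily) (Subalgebra.one_mem _)
  eventually_eq τ := by
    filter_upwards [(periods τ).eventually_nhdsNE_zero_notMem_lattice, self_mem_nhdsWithin]
      with z hz hz0
    rw [ext_of_notMem _ hz, wp_apply, PeriodPair.weierstrassP_eq_of_ne_zero, mul_add,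
      mul_inv_cancel₀ (pow_ne_zero 2 hz0)]
    rfl

lemma hasExpansion_dwp :
    HasExpansion dwp 3
      ((fun _ z ↦ z) ^ 3 * (fun τ ↦ (periods τ).derivWeierstrassPExcept 0) + (-2 : ℂ) • 1) where
  analyticAt τ z hz := by
    refine ((periods τ).analyticOnNhd_derivWeierstrassP z hz).congr ?_
    filter_upwards [(periods τ).eventually_notMem_lattice hz] with w hw
    rw [ext_of_notMem _ hw, dwp_apply]
  mem := Subalgebra.add_mem _ (Subalgebra.mul_mem _ (Subalgebra.pow_mem _ id_mem_analyticFamily 3)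
    derivWeierstrassPExcept_mem_analyticFamily) (Subalgebra.smul_mem _ (Subalgebra.one_mem _) _)
  eventually_eq τ := by
    filter_upwards [(periods τ).eventually_nhdsNE_zero_notMem_lattice, self_mem_nhdsWithin]
      with z hz hz0
    rw [ext_of_notMem _ hz, dwp_apply, PeriodPair.derivWeierstrassP_eq_of_ne_zero, mul_sub,
      mul_left_comm, mul_inv_cancel₀ (pow_ne_zero 3 hz0)]
    simp [sub_eq_add_neg]

/-- Taylor coefficients of `z ^ m * g z` at `0`. -/
lemma iteratedDeriv_pow_mul_zero {g : ℂ → ℂ} (hg : AnalyticAt ℂ g 0) (m n : ℕ) :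
    iteratedDeriv (m + n) (fun z ↦ z ^ m * g z) 0 =
      (m + n).choose m * m.factorial * iteratedDeriv n g 0 := by
  rw [iteratedDeriv_fun_mul (by fun_prop) hg.contDiffAt, Finset.sum_eq_single m]
  · rw [iteratedDeriv_fun_pow_zero, if_pos rfl, Nat.add_sub_cancel_left]
  · intro i _ hi
    rw [iteratedDeriv_fun_pow_zero, if_neg hi]
    simp
  · intro h
    simp at h

/-- If the leading coefficient vanishes, then the pole order drops. -/
lemma HasExpansion.exists_lower {f : Fun} {N : ℕ} {φ : ℍ → ℂ → ℂ} (h : HasExpansion f (N + 1) φ)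
    (h0 : ∀ τ, φ τ 0 = 0) : ∃ ψ, HasExpansion f N ψ := by
  have hex (τ : ℍ) : ∃ g : ℂ → ℂ, AnalyticAt ℂ g 0 ∧ ∀ᶠ z in 𝓝 0, φ τ z = z ^ 1 * g z := by
    have h1 : ((1 : ℕ) : ℕ∞) ≤ analyticOrderAt (φ τ) 0 := by
      rw [natCast_le_analyticOrderAt_iff_iteratedDeriv_eq_zero (h.mem.1 τ)]
      intro i hi
      interval_cases i
      simpa using h0 τ
    simpa using (natCast_le_analyticOrderAt (h.mem.1 τ)).mp h1
  choose ψ hψ hφψ using hex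
  refine ⟨ψ, h.analyticAt, ⟨hψ, fun n ↦ ?_⟩, fun τ ↦ ?_⟩
  -- Although `ψ` is chosen separately for each `τ`, its Taylor coefficients are those of `φ`
  -- shifted by one, so holomorphy in `τ` is inherited.
  · have h1 : (fun τ ↦ iteratedDeriv n (ψ τ) 0) =
        ((1 + n : ℂ)⁻¹) • fun τ ↦ iteratedDeriv (1 + n) (φ τ) 0 := by
      ext τ
      have h2 : (1 + n : ℂ) ≠ 0 := by exact_mod_cast (by omega : 1 + n ≠ 0)
      rw [Pi.smul_apply, Filter.EventuallyEq.iteratedDeriv_eq (1 + n) (hφψ τ), iteratedDeriv_pow_mul_zero (hψ τ)]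
      simp [h2]
    rw [h1]
    exact Subalgebra.smul_mem _ (h.mem.2 _) _
  · filter_upwards [h.eventually_eq τ, (hφψ τ).filter_mono nhdsWithin_le_nhds,
      self_mem_nhdsWithin] with z h1 h2 hz
    have hz : z ≠ 0 := hz
    apply mul_left_cancel₀ hz
    rw [pow_one] at h2
    rw [← h2, ← h1]
    ring

end SingularJacobi

/-! ### Singular Jacobi forms as invariant functions with an expansion. -/

namespace SingularJacobi

open Filter

/-- Invariant functions are elliptic. -/
lemma ext_add_of_mem_invariant {k : ℕ} {f : Fun} (hf : f ∈ Invariant k) {τ : ℍ} (z : ℂ) {w : ℂ}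
    (hw : w ∈ (periods τ).lattice) : f.ext τ (z + w) = f.ext τ z := by
  by_cases hz : z ∈ (periods τ).lattice
  · rw [ext_of_mem _ hz, ext_of_mem _ (add_mem hz hw)]
  · obtain ⟨m, n, rfl⟩ := mem_lattice_periods.mp hw
    have h := hf 1 n m τ z hz
    simp only [autFactor, one_smul] at h
    simp only [Matrix.SpecialLinearGroup.coe_one, Matrix.one_apply_eq, Int.cast_one, ne_eq,
      one_ne_zero, not_false_eq_true, Matrix.one_apply_ne, Int.cast_zero, zero_mul, zero_add,
      div_one, one_pow, one_mul] at h
    rw [← h]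
    congr 1
    ring

lemma meromorphicAt_ext_of_mem_lattice {k : ℕ} {f : Fun} (hf : f ∈ Invariant k) {τ : ℍ} {w : ℂ}
    (hw : w ∈ (periods τ).lattice) (h0 : MeromorphicAt (f.ext τ) 0) :
    MeromorphicAt (f.ext τ) w ∧
      meromorphicOrderAt (f.ext τ) w = meromorphicOrderAt (f.ext τ) 0 := by
  have h1 : f.ext τ = f.ext τ ∘ (· - w) := by
    ext z
    simpa [sub_eq_add_neg] using (ext_add_of_mem_invariant hf z (neg_mem hw)).symm
  have hg : AnalyticAt ℂ (fun z ↦ z - w) w := by fun_prop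
  constructor
  · rw [h1]
    exact MeromorphicAt.comp_analyticAt (by simpa using h0) hg
  · rw [h1, meromorphicOrderAt_comp_of_deriv_ne_zero hg (by simp), ← h1, sub_self]

lemma HasExpansion.meromorphicAt_zero {f : Fun} {N : ℕ} {φ : ℍ → ℂ → ℂ} (h : HasExpansion f N φ)
    (τ : ℍ) : MeromorphicAt (f.ext τ) 0 ∧
      ((-N : ℤ) : WithTop ℤ) ≤ meromorphicOrderAt (f.ext τ) 0 := by
  have h1 : f.ext τ =ᶠ[𝓝[≠] 0] (fun z ↦ z ^ (-N : ℤ)) * φ τ := by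
    filter_upwards [h.eventually_eq τ, self_mem_nhdsWithin] with z hz hz0
    have hz0 : z ≠ 0 := hz0
    rw [Pi.mul_apply, ← hz, zpow_neg, zpow_natCast, inv_mul_cancel_left₀ (pow_ne_zero N hz0)]
  have hid : MeromorphicAt (fun z : ℂ ↦ z) 0 := MeromorphicAt.id 0
  have hpow : MeromorphicAt (fun z : ℂ ↦ z ^ (-N : ℤ)) 0 := hid.zpow _
  have hφ := h.mem.1 τ
  refine ⟨(hpow.mul hφ.meromorphicAt).congr h1.symm, ?_⟩
  have hord : meromorphicOrderAt (fun z : ℂ ↦ z ^ (-N : ℤ)) 0 = ((-N : ℤ) : WithTop ℤ) := by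
    rw [meromorphicOrderAt_eq_int_iff hpow]
    exact ⟨1, analyticAt_const, one_ne_zero, .of_forall fun z ↦ by simp⟩
  rw [meromorphicOrderAt_congr h1, meromorphicOrderAt_mul hpow hφ.meromorphicAt, hord]
  exact le_add_of_nonneg_right hφ.meromorphicOrderAt_nonneg

/-- Infinite order is harmless: its pole order is `0` by default, and both sides hold. -/
lemma poleOrderAt_le_iff {g : ℂ → ℂ} {w : ℂ} {N : ℕ} :
    poleOrderAt g w ≤ N ↔ ((-N : ℤ) : WithTop ℤ) ≤ meromorphicOrderAt g w := by
  rw [poleOrderAt]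
  cases h : meromorphicOrderAt g w with
  | top => simp
  | coe n =>
    rw [WithTop.untopD_coe, WithTop.coe_le_coe]
    omega

/-- The Laurent coefficients determined by an expansion. -/
lemma HasExpansion.hasLaurentExpansionAtZero {f : Fun} {N : ℕ} {φ : ℍ → ℂ → ℂ}
    (h : HasExpansion f N φ) (τ : ℍ) : HasLaurentExpansionAtZero (f.ext τ) fun n ↦
      if 0 ≤ n + N then
        iteratedDeriv (n + N).toNat (φ τ) 0 / (n + N).toNat.factorial else 0 := by
  refine ⟨⟨N, fun n hn ↦ if_neg (by omega)⟩, ?_⟩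
  have h1 := hasFPowerSeriesAt_iff.mp (h.mem.1 τ).hasFPowerSeriesAt
  filter_upwards [h.eventually_eq τ, self_mem_nhdsWithin,
    h1.filter_mono nhdsWithin_le_nhds] with z hz hz0 h2
  have hz0 : z ≠ 0 := hz0
  simp only [zero_add, FormalMultilinearSeries.coeff_ofScalars, smul_eq_mul] at h2
  have hinj : Function.Injective (fun m : ℕ ↦ (m : ℤ) - N) := fun a b hab ↦ by
    simp only at hab
    omega
  rw [← hinj.hasSum_iff]
  · have h3 := h2.mul_left ((z ^ N)⁻¹)
    rw [← hz, inv_mul_cancel_left₀ (pow_ne_zero N hz0)] at h3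
    refine h3.congr_fun fun m ↦ ?_
    simp only [Function.comp_apply, sub_add_cancel, Nat.cast_nonneg, if_true, Int.toNat_natCast]
    rw [zpow_sub₀ hz0, zpow_natCast, zpow_natCast]
    ring
  · intro n hn
    rw [if_neg, zero_mul]
    intro h0
    exact hn ⟨(n + N).toNat, by simp only; omega⟩

/-- Ellipticity transports the behaviour at `0` to every lattice point, and periodicity in `τ` is
invariance under `T`. -/
theorem isSingularJacobiForm_of_hasExpansion {k : ℕ} {f : Fun} (hf : f ∈ Invariant k) {N : ℕ}
    {φ : ℍ → ℂ → ℂ} (h : HasExpansion f N φ) : IsSingularJacobiForm k 0 f where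
  slash_eq := mem_invariant_iff.mp hf
  singular :=
    { periodic_z := fun τ z ↦
        ext_add_of_mem_invariant hf z (mem_lattice_periods.mpr ⟨1, 0, by simp⟩)
      meromorphic := fun τ z ↦ by
        by_cases hz : z ∈ (periods τ).lattice
        · exact (meromorphicAt_ext_of_mem_lattice hf hz (h.meromorphicAt_zero τ).1).1
        · exact (h.analyticAt τ z hz).meromorphicAt
      analyticAt := h.analyticAt
      same_order := fun τ w hw ↦ by
        rw [poleOrderAt, poleOrderAt,
          (meromorphicAt_ext_of_mem_lattice hf hw (h.meromorphicAt_zero τ).1).2]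
      order_bound := ⟨N, fun τ ↦ poleOrderAt_le_iff.mpr (h.meromorphicAt_zero τ).2⟩
      periodic_tau := fun τ z ↦ by
        have h1 := congrFun₂ (mem_invariant_iff.mp hf ModularGroup.T 0 0) τ z
        rw [slash_zero_apply, modular_T_smul] at h1
        simpa [autFactor, ModularGroup.coe_T] using h1
      laurent := by
        refine ⟨fun n τ ↦ if 0 ≤ n + N then
          iteratedDeriv (n + N).toNat (φ τ) 0 / (n + N).toNat.factorial else 0,
          h.hasLaurentExpansionAtZero, fun n ↦ ?_⟩
        suffices hm : (fun τ ↦ if 0 ≤ n + N then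
            iteratedDeriv (n + N).toNat (φ τ) 0 / (n + N).toNat.factorial else 0) ∈
            holomorphicAtInfty from ⟨hm.1, hasFourierExpansion_of_mem hm⟩
        split_ifs
        · have h1 := Subalgebra.smul_mem _ (h.mem.2 (n + N).toNat)
            (((n + N).toNat.factorial : ℂ)⁻¹)
          refine (congrArg (· ∈ holomorphicAtInfty) ?_).mp h1
          ext τ
          simp [div_eq_inv_mul]
        · exact Subalgebra.zero_mem _ }

/-- A function with a Laurent expansion and a pole of order at most `N`. -/
lemma exists_analyticAt_of_hasLaurentExpansionAtZero {g : ℂ → ℂ} {a : ℤ → ℂ} {N : ℕ}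
    (hg : MeromorphicAt g 0) (hN : poleOrderAt g 0 ≤ N) (ha : HasLaurentExpansionAtZero g a) :
    ∃ φ : ℂ → ℂ, AnalyticAt ℂ φ 0 ∧ (∀ᶠ z in 𝓝[≠] 0, z ^ N * g z = φ z) ∧
      ∀ n : ℕ, iteratedDeriv n φ 0 = n.factorial * a (n - N) := by
  have hid : MeromorphicAt (fun z : ℂ ↦ z) 0 := MeromorphicAt.id 0
  have hpow : MeromorphicAt (fun z : ℂ ↦ z ^ N) 0 := hid.pow _
  have hord : meromorphicOrderAt (fun z : ℂ ↦ z ^ N) 0 = ((N : ℤ) : WithTop ℤ) := by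
    rw [meromorphicOrderAt_eq_int_iff hpow]
    exact ⟨1, analyticAt_const, one_ne_zero, .of_forall fun z ↦ by simp⟩
  have hmer : MeromorphicAt ((fun z : ℂ ↦ z ^ N) * g) 0 := hpow.mul hg
  have hge : 0 ≤ meromorphicOrderAt ((fun z : ℂ ↦ z ^ N) * g) 0 := by
    rw [meromorphicOrderAt_mul hpow hg, hord]
    have h1 := add_le_add_right (poleOrderAt_le_iff.mp hN) ((N : ℤ) : WithTop ℤ)
    rw [← WithTop.coe_add] at h1
    simpa using h1
  set φ := toMeromorphicNFAt ((fun z : ℂ ↦ z ^ N) * g) 0 with hφdef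
  have heq := hmer.eq_nhdsNE_toMeromorphicNFAt
  have hφ : AnalyticAt ℂ φ 0 := by
    rw [← meromorphicNFAt_toMeromorphicNFAt.meromorphicOrderAt_nonneg_iff_analyticAt,
      ← meromorphicOrderAt_congr heq]
    exact hge
  refine ⟨φ, hφ, heq, fun n ↦ ?_⟩
  -- `M` bounds the support of `a` and `N` the pole order; using `M + N` avoids comparing them.
  obtain ⟨⟨M, hM⟩, hsum⟩ := ha
  -- multiply by a higher power of `z` to get an ordinary power series
  set ψ : ℂ → ℂ := fun z ↦ if z = 0 then a (-(M + N : ℕ)) else z ^ (M + N) * g z with hψdef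
  have hψser : HasFPowerSeriesAt ψ
      (.ofScalars ℂ fun m : ℕ ↦ a (m - (M + N : ℕ))) 0 := by
    rw [hasFPowerSeriesAt_iff]
    rw [eventually_nhdsWithin_iff] at hsum
    filter_upwards [hsum] with z hz
    simp only [zero_add, FormalMultilinearSeries.coeff_ofScalars, smul_eq_mul]
    by_cases hz0 : z = 0
    · subst hz0
      have h1 := hasSum_ite_eq 0 (a (-(M + N : ℕ)))
      refine (show ψ 0 = a (-(M + N : ℕ)) by simp [hψdef]) ▸ h1.congr_fun fun m ↦ ?_
      by_cases hm : m = 0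
      · simp [hm]
      · simp [hm]
    · have h1 := (hz hz0).mul_left (z ^ (M + N))
      have hinj : Function.Injective (fun m : ℕ ↦ (m : ℤ) - (M + N : ℕ)) := fun b c hbc ↦ by
        simp only at hbc
        omega
      rw [← hinj.hasSum_iff] at h1
      · simp only [hψdef, if_neg hz0]
        refine h1.congr_fun fun m ↦ ?_
        simp only [Function.comp_apply]
        rw [zpow_sub₀ hz0, zpow_natCast, zpow_natCast]
        field_simp
      · intro m hm
        rw [hM m, zero_mul, mul_zero]
        by_contra hlt
        exact hm ⟨(m + (M + N : ℕ)).toNat, by simp only; omega⟩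
  -- The two sides agree off `0` and are continuous at `0`. Uniqueness of power series then
  -- identifies the coefficients of `φ` with shifted values of `a`.
  have hψφ : ψ =ᶠ[𝓝 0] fun z ↦ z ^ M * φ z := by
    rw [← ContinuousAt.eventuallyEq_nhds_iff_eventuallyEq_nhdsNE hψser.continuousAt (by fun_prop)]
    filter_upwards [heq, self_mem_nhdsWithin] with z hz hz0
    rw [← hφdef] at hz
    have hz0 : z ≠ 0 := hz0
    rw [← hz, hψdef]
    simp only [if_neg hz0, Pi.mul_apply]
    ring
  have h1 := congrArg (FormalMultilinearSeries.coeff · (M + n))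
    (hψser.analyticAt.hasFPowerSeriesAt.eq_formalMultilinearSeries hψser)
  simp only [FormalMultilinearSeries.coeff_ofScalars] at h1
  rw [hψφ.iteratedDeriv_eq, iteratedDeriv_pow_mul_zero hφ, 
    div_eq_iff (Nat.cast_ne_zero.mpr (Nat.factorial_ne_zero _))] at h1
  have h2 : ((M + n : ℕ) : ℤ) - (M + N : ℕ) = n - N := by push_cast; ring
  rw [h2] at h1
  have h3 : ((M + n).choose M * M.factorial : ℂ) * n.factorial = (M + n).factorial := by
    rw [Nat.choose_symm_add]
    exact_mod_cast Nat.add_choose_mul_factorial_mul_factorial M n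
  have h4 : ((M + n).choose M * M.factorial : ℂ) ≠ 0 := by
    exact_mod_cast (Nat.mul_pos (Nat.choose_pos (Nat.le_add_right M n)) M.factorial_pos).ne'
  apply mul_left_cancel₀ h4
  rw [h1, ← h3]
  ring

/-- The pole bound uniform in `τ` supplies a single `N`, the quantity on which the descent inducts.
-/
theorem IsSingularJacobiForm.exists_hasExpansion {k : ℕ} {f : Fun}
    (hf : IsSingularJacobiForm k 0 f) : f ∈ Invariant k ∧ ∃ N φ, HasExpansion f N φ := by
  refine ⟨mem_invariant_iff.mpr hf.slash_eq, ?_⟩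
  obtain ⟨N, hN⟩ := hf.singular.order_bound
  obtain ⟨A, hA, hA'⟩ := hf.singular.laurent
  choose φ hφ h1 h2 using fun τ ↦ exists_analyticAt_of_hasLaurentExpansionAtZero
    (hf.singular.meromorphic τ 0) (hN τ) (hA τ)
  refine ⟨N, φ, hf.singular.analyticAt, ⟨hφ, fun n ↦ ?_⟩, h1⟩
  simp only [h2]
  exact Subalgebra.smul_mem _ (mem_holomorphicAtInfty_of_hasFourierExpansion
    (hA' (n - N)).1 (hA' (n - N)).2) _

end SingularJacobi

/-! ### The descent on the pole order. -/

namespace SingularJacobi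

open Filter

instance : SetLike.GradedMonoid JSk where
  one_mem := Submodule.subset_span ⟨0, 0, 0, rfl, by simp⟩
  mul_mem k l f g hf hg := by
    have h := Submodule.mul_mem_mul hf hg
    rw [JSk, JSk, Submodule.span_mul_span] at h
    refine Submodule.span_mono ?_ h
    rintro _ ⟨_, ⟨a, b, c, rfl, rfl⟩, _, ⟨a', b', c', rfl, rfl⟩, rfl⟩
    exact ⟨a + a', b + b', c + c', by ring, by ring⟩

lemma monomial_mem_JSk {a b c k : ℕ} (h : 2 * a + 3 * b + 4 * c = k) :
    wp ^ a * dwp ^ b * e4 ^ c ∈ JSk k := Submodule.subset_span ⟨a, b, c, h, rfl⟩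

/-- The Weierstrass equation. -/
lemma pullback_eis_six : pullback (eis 6) =
    (1 / 140 : ℂ) • ((4 : ℂ) • (wp ^ 3 * dwp ^ 0 * e4 ^ 0) - wp ^ 0 * dwp ^ 2 * e4 ^ 0 -
      (60 : ℂ) • (wp ^ 1 * dwp ^ 0 * e4 ^ 1)) := by
  ext p
  have h := (periods p.1.1).derivWeierstrassP_sq p.1.2 p.2
  rw [← wp_apply, ← dwp_apply, PeriodPair.g₂, PeriodPair.g₃, ← e4_apply] at h
  simp only [pullback_apply, eis, Pi.smul_apply, Pi.sub_apply, Pi.mul_apply, Pi.pow_apply,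
    smul_eq_mul, pow_zero, mul_one, one_mul, pow_one]
  rw [h]
  ring

lemma pullback_eis_six_mem_JSk : pullback (eis 6) ∈ JSk 6 := by
  rw [pullback_eis_six]
  exact Submodule.smul_mem _ _ (Submodule.sub_mem _ (Submodule.sub_mem _
    (Submodule.smul_mem _ _ (monomial_mem_JSk rfl)) (monomial_mem_JSk rfl))
    (Submodule.smul_mem _ _ (monomial_mem_JSk rfl)))

lemma pullback_mem_JSk {k : ℕ} {F : ℍ → ℂ} (hF : F ∈ eisSpan k) : pullback F ∈ JSk k := by
  suffices eisSpan k ≤ (JSk k).comap pullback.toLinearMap from this hF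
  refine Submodule.span_le.mpr ?_
  rintro _ ⟨a, b, rfl, rfl⟩
  have h4 : e4 ^ a ∈ JSk (4 * a) := by simpa using monomial_mem_JSk (a := 0) (b := 0) (c := a) rfl
  have h6 : pullback (eis 6) ^ b ∈ JSk (6 * b) := by
    rw [mul_comm]
    exact SetLike.pow_mem_graded b pullback_eis_six_mem_JSk
  simpa [pullback_eis_four] using SetLike.GradedMul.mul_mem h4 h6

lemma monomial_mem_invariant {a b c k : ℕ} (h : 2 * a + 3 * b + 4 * c = k) :
    wp ^ a * dwp ^ b * e4 ^ c ∈ Invariant k := by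
  have h4 : e4 ∈ Invariant 4 := pullback_mem_invariant (eis_smul 4)
  have h1 := SetLike.GradedMul.mul_mem (SetLike.GradedMul.mul_mem
    (SetLike.pow_mem_graded a wp_mem_invariant) (SetLike.pow_mem_graded b dwp_mem_invariant))
    (SetLike.pow_mem_graded c h4)
  have h2 : a • 2 + b • 3 + c • 4 = k := by
    simp only [smul_eq_mul]
    omega
  rwa [h2] at h1

lemma JSk_le_invariant (k : ℕ) : JSk k ≤ Invariant k := by
  refine Submodule.span_le.mpr ?_
  rintro _ ⟨a, b, c, h, rfl⟩
  exact monomial_mem_invariant h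

lemma exists_hasExpansion_of_mem_JSk {k : ℕ} {f : Fun} (hf : f ∈ JSk k) :
    ∃ N φ, HasExpansion f N φ := by
  induction hf using Submodule.span_induction with
  | mem f hf =>
    obtain ⟨a, b, c, -, rfl⟩ := hf
    have h4 := hasExpansion_pullback (eis_mem_holomorphicAtInfty (n := 4) (by norm_num))
    exact ⟨_, _, ((hasExpansion_wp.pow a).mul (hasExpansion_dwp.pow b)).mul (h4.pow c)⟩
  | zero => exact ⟨_, _, hasExpansion_pullback (Subalgebra.zero_mem _)⟩
  | add f g _ _ hf hg =>
    obtain ⟨N, φ, hφ⟩ := hf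
    obtain ⟨M, ψ, hψ⟩ := hg
    exact ⟨_, _, hφ.mono.add (Nat.add_comm M N ▸ hψ.mono)⟩
  | smul c f _ hf =>
    obtain ⟨N, φ, hφ⟩ := hf
    exact ⟨_, _, hφ.smul c⟩

/-- The leading coefficient of an invariant function of weight `k` transforms with weight
`k - N`. -/
lemma HasExpansion.leading_smul {k : ℕ} {f : Fun} (hf : f ∈ Invariant k) {N : ℕ}
    {φ : ℍ → ℂ → ℂ} (h : HasExpansion f N φ) (g : SL(2, ℤ)) (τ : ℍ) :
    φ (g • τ) 0 = autFactor g τ ^ ((k : ℤ) - N) * φ τ 0 := by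
  have hj := autFactor_ne_zero g τ
  set j := autFactor g τ with hjdef
  have hdiv : ContinuousAt (fun z : ℂ ↦ z / j) 0 := by fun_prop
  have hdiv' : Tendsto (fun z : ℂ ↦ z / j) (𝓝[≠] 0) (𝓝[≠] 0) := by
    refine tendsto_nhdsWithin_iff.mpr ⟨?_, ?_⟩
    · have := hdiv.tendsto
      rw [zero_div] at this
      exact this.mono_left nhdsWithin_le_nhds
    · filter_upwards [self_mem_nhdsWithin] with z hz
      simpa [hj] using hz
  -- Multiplying `f(gτ, z/j) = j^k f(τ, z)` by `(z/j)^N` produces the exponent `k - N`; continuity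
  -- then allows `z = 0`.
  have heq : (fun z ↦ φ (g • τ) (z / j)) =ᶠ[𝓝[≠] 0]
      fun z ↦ j ^ ((k : ℤ) - N) * φ τ z := by
    filter_upwards [hdiv'.eventually (h.eventually_eq (g • τ)), h.eventually_eq τ,
      (periods τ).eventually_nhdsNE_zero_notMem_lattice] with z h1 h2 hz
    have h3 := hf g 0 0 τ z hz
    simp only [Int.cast_zero, zero_mul, add_zero, ← hjdef] at h3
    rw [← h1, ← h2, h3, zpow_sub₀ hj, zpow_natCast, zpow_natCast, div_pow]
    field_simp
  have hc : ContinuousAt (fun z ↦ φ (g • τ) (z / j)) 0 := by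
    have hc0 : ContinuousAt (φ (g • τ)) (0 / j) := by
      rw [zero_div]
      exact (h.mem.1 _).continuousAt
    exact ContinuousAt.comp (f := fun z : ℂ ↦ z / j) hc0 hdiv
  have hc' : ContinuousAt (fun z ↦ j ^ ((k : ℤ) - N) * φ τ z) 0 :=
    continuousAt_const.mul (h.mem.1 τ).continuousAt
  simpa using ((hc.eventuallyEq_nhds_iff_eventuallyEq_nhdsNE hc').mp heq).eq_of_nhds

lemma HasExpansion.exists_modularForm {k : ℕ} {f : Fun} (hf : f ∈ Invariant k) {N : ℕ}
    {φ : ℍ → ℂ → ℂ} (h : HasExpansion f N φ) :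
    ∃ F : ModularForm 𝒮ℒ ((k : ℤ) - N), (F : ℍ → ℂ) = fun τ ↦ φ τ 0 := by
  have h0 : (fun τ ↦ φ τ 0) ∈ holomorphicAtInfty := by simpa using h.mem.2 0
  exact SingularJacobi.exists_modularForm h0.1 h0.2.1 (h.leading_smul hf)

/-- The monomials `℘^a (∂_z ℘)^b` realise every pole order except `1`. -/
lemma exists_two_mul_add_three_mul (N : ℕ) : ∃ a b : ℕ, 2 * a + 3 * b = N + 2 := by
  rcases Nat.even_or_odd N with ⟨n, rfl⟩ | ⟨n, rfl⟩
  · exact ⟨n + 1, 0, by ring⟩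
  · exact ⟨n, 1, by ring⟩

/-- Invariant functions with an expansion are polynomials in `℘`, `∂_z ℘` and `e₄`. -/
theorem mem_JSk_of_hasExpansion {k N : ℕ} {f : Fun} (hf : f ∈ Invariant k) {φ : ℍ → ℂ → ℂ}
    (h : HasExpansion f N φ) : f ∈ JSk k := by
  induction N using Nat.strong_induction_on generalizing f φ with | _ N ih =>
  have hper (τ : ℍ) : ∀ z ∉ (periods τ).lattice, ∀ l ∈ (periods τ).lattice,
      f.ext τ (z + l) = f.ext τ z := fun z _ l hl ↦ ext_add_of_mem_invariant hf z hl
  obtain ⟨F, hF⟩ := h.exists_modularForm hf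
  match N with
  | 0 =>
    have hfF : f = pullback fun τ ↦ φ τ 0 := by
      ext ⟨⟨τ, z⟩, hz⟩
      have h1 := (periods τ).eq_of_analyticAt_of_periodic (h.analyticAt τ) (hper τ) (h.mem.1 τ)
        (by simpa using h.eventually_eq τ) z hz
      rwa [ext_of_notMem f hz] at h1
    rw [hfF, ← hF]
    have hk : (k : ℤ) - (0 : ℕ) = k := by simp
    have h1 := modularForm_mem_eisSpan k (ModularForm.mcast hk F)
    rw [ModularForm.coe_mcast] at h1
    exact pullback_mem_JSk h1
  | 1 =>
    obtain ⟨ψ, hψ⟩ := h.exists_lower fun τ ↦ (periods τ).residue_eq_zero_of_simple_pole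
      (g₂_cube_ne τ) (h.analyticAt τ) (hper τ) (h.mem.1 τ) (by simpa using h.eventually_eq τ)
    exact ih 0 one_pos hf hψ
  | N + 2 =>
    rcases lt_or_ge k (N + 2) with hk | hk
    -- The leading coefficient has negative weight, so it vanishes and the order drops at once.
    · have hF0 : F = 0 := rank_zero_iff_forall_zero.mp
        (ModularForm.levelOne_neg_weight_rank_zero (by push_cast; omega)) F
      rw [hF0, FunLike.coe_zero] at hF
      obtain ⟨ψ, hψ⟩ := h.exists_lower fun τ ↦ (congrFun hF τ).symm
      exact ih (N + 1) (Nat.lt_succ_self _) hf hψ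
    obtain ⟨a, b, hab⟩ := exists_two_mul_add_three_mul N
    set A : ℍ → ℂ := fun τ ↦ φ τ 0
    have hA : A ∈ eisSpan (k - (N + 2)) := by
      have hk' : (k : ℤ) - (N + 2 : ℕ) = ((k - (N + 2) : ℕ) : ℤ) := by omega
      have h1 := modularForm_mem_eisSpan _ (ModularForm.mcast hk' F)
      rwa [ModularForm.coe_mcast, hF] at h1
    have hAh : A ∈ holomorphicAtInfty := hF ▸ modularForm_mem_holomorphicAtInfty F
    set m : Fun := pullback A * (wp ^ a * dwp ^ b) with hm
    have hmJ : m ∈ JSk k := by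
      have h1 : wp ^ a * dwp ^ b ∈ JSk (N + 2) := by
        simpa using monomial_mem_JSk (a := a) (b := b) (c := 0) (by simpa using hab)
      have h2 := SetLike.GradedMul.mul_mem (pullback_mem_JSk hA) h1
      rwa [Nat.sub_add_cancel hk] at h2
    have hmE := (hasExpansion_pullback hAh).mul
      ((hasExpansion_wp.pow a).mul (hasExpansion_dwp.pow b))
    rw [hab, zero_add, ← hm] at hmE
    -- The leading coefficient of `m` is `(-2)^b A`, since `∂_z ℘` begins with `-2z⁻³`; this scalar
    -- makes the leading terms cancel.
    have hdE := h.add (hmE.smul (-((-2 : ℂ) ^ b)⁻¹))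
    set c : ℂ := -((-2 : ℂ) ^ b)⁻¹ with hc
    have hd : f + c • m ∈ Invariant k :=
      Submodule.add_mem _ hf (Submodule.smul_mem _ _ (JSk_le_invariant k hmJ))
    obtain ⟨ψ, hψ⟩ := hdE.exists_lower fun τ ↦ by
      have h2 : (-2 : ℂ) ^ b ≠ 0 := pow_ne_zero b (by norm_num)
      simp only [Pi.add_apply, Pi.smul_apply, Pi.mul_apply, Pi.pow_apply, Pi.one_apply,
        smul_eq_mul, ne_eq, OfNat.ofNat_ne_zero, not_false_eq_true, zero_pow, zero_mul, zero_add,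
        one_pow, one_mul, mul_one, hc]
      rw [mul_comm (A τ), neg_mul, inv_mul_cancel_left₀ h2]
      exact add_neg_cancel _
    have h3 := Submodule.sub_mem _ (ih (N + 1) (Nat.lt_succ_self _) hd hψ)
      (Submodule.smul_mem _ c hmJ)
    rwa [add_sub_cancel_right] at h3

theorem coe_JSk_eq (k : ℕ) : (JSk k : Set Fun) = {f | IsSingularJacobiForm k 0 f} := by
  ext f
  constructor
  · intro hf
    obtain ⟨N, φ, h⟩ := exists_hasExpansion_of_mem_JSk hf
    exact isSingularJacobiForm_of_hasExpansion (JSk_le_invariant k hf) h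
  · intro hf
    obtain ⟨hinv, N, φ, h⟩ := IsSingularJacobiForm.exists_hasExpansion hf
    exact mem_JSk_of_hasExpansion hinv h

end SingularJacobi

/-! ### Grading and algebraic independence. -/

namespace SingularJacobi

open Filter ModularForm EisensteinSeries

lemma tendsto_E_atImInfty {k : ℕ} (hk : 3 ≤ k) (hk2 : Even k) :
    Tendsto (E hk) atImInfty (𝓝 1) := by
  have h1 := ModularFormClass.differentiableAt_cuspFunction (E hk) one_pos
    one_mem_strictPeriods_SL (q := 0) (by simp)
  have h0 : cuspFunction 1 (E hk) 0 = 1 := by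
    rw [← E_qExpansion_coeff_zero hk hk2, qExpansion_coeff]
    simp
  have h2 := h1.continuousAt.tendsto.comp (qParam_tendsto_atImInfty one_pos)
  rw [h0] at h2
  refine h2.congr fun τ ↦ ?_
  exact SlashInvariantFormClass.eq_cuspFunction (E hk) τ one_mem_strictPeriods_SL one_ne_zero

/-- The modular function `G₄³ / G₆²` takes infinitely many values. -/
lemma infinite_range_eis_quotient :
    {u : ℂ | ∃ τ : ℍ, eis 4 τ ≠ 0 ∧ eis 6 τ ≠ 0 ∧ u = eis 4 τ ^ 3 / eis 6 τ ^ 2}.Infinite := by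
  set c : ℂ := (49 / 20 : ℂ) with hc
  have hpi := pi_ne_zero_complex
  have hquot (τ : ℍ) : eis 4 τ ^ 3 / eis 6 τ ^ 2 = c * (E₄ τ ^ 3 / E₆ τ ^ 2) := by
    rw [eis_four_eq, eis_six_eq, hc]
    field_simp
    ring
  intro hfin
  have h4 : Tendsto E₄ atImInfty (𝓝 1) := tendsto_E_atImInfty _ ⟨2, rfl⟩
  have h6 : Tendsto E₆ atImInfty (𝓝 1) := tendsto_E_atImInfty _ ⟨3, rfl⟩
  have hlim : Tendsto (fun τ ↦ eis 4 τ ^ 3 / eis 6 τ ^ 2) atImInfty (𝓝 c) := by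
    have := ((h4.pow 3).div (h6.pow 2) (by simp)).const_mul c
    simp only [one_pow, div_one, mul_one] at this
    exact this.congr fun τ ↦ (hquot τ).symm
  set S := {u : ℂ | ∃ τ : ℍ, eis 4 τ ≠ 0 ∧ eis 6 τ ≠ 0 ∧ u = eis 4 τ ^ 3 / eis 6 τ ^ 2}
  -- The limit `c` at `i∞` would force `E₄³ = E₆²` if attained. A finite set of values is closed, so
  -- it cannot accumulate at a point outside it.
  have hcS : c ∉ S := by
    rintro ⟨τ, h4', h6', h⟩
    have h6'' : E₆ τ ≠ 0 := fun h0 ↦ h6' (by rw [eis_six_eq, h0, mul_zero])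
    rw [hquot, eq_comm, mul_eq_left₀ (by norm_num [hc]), div_eq_one_iff_eq (pow_ne_zero 2 h6'')] at h
    exact E₄_cube_ne_E₆_sq τ h
  obtain ⟨τ, hτ, h4τ, h6τ⟩ := ((hlim.eventually (hfin.isClosed.isOpen_compl.mem_nhds hcS)).and
    ((h4.eventually_ne one_ne_zero).and (h6.eventually_ne one_ne_zero))).exists
  refine hτ ⟨τ, ?_, ?_, rfl⟩
  · rw [eis_four_eq]
    exact mul_ne_zero (div_ne_zero (pow_ne_zero 4 hpi) (by norm_num)) h4τ
  · rw [eis_six_eq]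
    exact mul_ne_zero (div_ne_zero (mul_ne_zero two_ne_zero (pow_ne_zero 6 hpi)) (by norm_num)) h6τ

lemma infinite_range_autFactor (τ : ℍ) : (Set.range fun g : SL(2, ℤ) ↦ autFactor g τ).Infinite := by
  have hinj : Function.Injective fun n : ℕ ↦ (n : ℂ) * τ + 1 := fun a b hab ↦ by
    have h : (a : ℂ) * τ = b * τ := add_right_cancel hab
    exact_mod_cast mul_right_cancel₀ τ.ne_zero h
  refine (Set.infinite_range_of_injective hinj).mono ?_
  rintro _ ⟨n, rfl⟩
  exact ⟨⟨!![1, 0; (n : ℤ), 1], by simp [Matrix.det_fin_two]⟩, by simp [autFactor]⟩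

/-- Invariant functions of different weights are linearly independent. -/
theorem iSupIndep_invariant : iSupIndep Invariant := by
  rw [iSupIndep_iff_finsetSum_eq_zero_imp_eq_zero]
  intro s f hf hsum k hk
  ext ⟨⟨τ, z⟩, hz⟩
  -- Evaluating the relation at `(gτ, z / (cτ + d))` makes `cτ + d` a root of this polynomial for
  -- every `g`.
  have hp : (∑ i ∈ s, Polynomial.C ((f i).ext τ z) * Polynomial.X ^ i) = 0 := by
    refine Polynomial.eq_zero_of_infinite_isRoot _ ((infinite_range_autFactor τ).mono ?_)
    rintro _ ⟨g, rfl⟩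
    have hz' : z / autFactor g τ ∉ (periods (g • τ)).lattice := by
      have := (translate_div_mem_lattice_iff g 0 0 τ z).not.mpr hz
      simpa using this
    have h1 := congrFun hsum ⟨(g • τ, z / autFactor g τ), hz'⟩
    rw [Finset.sum_apply] at h1
    simp only [Set.mem_ofPred_eq, Polynomial.IsRoot, Polynomial.eval_finsetSum,
      Polynomial.eval_mul, Polynomial.eval_C, Polynomial.eval_pow, Polynomial.eval_X]
    rw [← show _ = (0 : ℂ) from h1]
    refine Finset.sum_congr rfl fun i hi ↦ ?_
    have h2 := hf i hi g 0 0 τ z hz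
    simp only [Int.cast_zero, zero_mul, add_zero] at h2
    rw [← ext_of_notMem (f i) hz', h2, mul_comm]
  have h := congrArg (Polynomial.coeff · k) hp
  simp only [Polynomial.finsetSum_coeff, Polynomial.coeff_C_mul_X_pow, Polynomial.coeff_zero,
    Finset.sum_ite_eq, if_pos hk] at h
  rwa [ext_of_notMem _ hz] at h

theorem iSupIndep_JSk : iSupIndep JSk := iSupIndep_invariant.mono JSk_le_invariant

theorem iSup_JSk : (⨆ k : ℕ, JSk k) = Subalgebra.toSubmodule JS := by
  rw [JS, Algebra.adjoin_eq_span]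
  apply le_antisymm
  · refine iSup_le fun k ↦ Submodule.span_le.mpr ?_
    rintro _ ⟨a, b, c, -, rfl⟩
    refine Submodule.subset_span (mul_mem (mul_mem ?_ ?_) ?_) <;>
    exact pow_mem (Submonoid.subset_closure (by simp)) _
  · refine Submodule.span_le.mpr fun f hf ↦ ?_
    suffices ∃ a b c : ℕ, f = wp ^ a * dwp ^ b * e4 ^ c by
      obtain ⟨a, b, c, rfl⟩ := this
      exact Submodule.mem_iSup_of_mem _ (monomial_mem_JSk rfl)
    induction hf using Submonoid.closure_induction with
    | mem f hf =>
      rcases hf with rfl | rfl | rfl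
      · exact ⟨1, 0, 0, by simp⟩
      · exact ⟨0, 1, 0, by simp⟩
      · exact ⟨0, 0, 1, by simp⟩
    | one => exact ⟨0, 0, 0, by simp⟩
    | mul f g _ _ hf hg =>
      obtain ⟨a, b, c, rfl⟩ := hf
      obtain ⟨a', b', c', rfl⟩ := hg
      exact ⟨a + a', b + b', c + c', by ring⟩

theorem span_isSingularJacobiForm :
    Submodule.span ℂ {f : Fun | ∃ k : ℕ, IsSingularJacobiForm k 0 f} =
      Subalgebra.toSubmodule JS := by
  have h : {f : Fun | ∃ k : ℕ, IsSingularJacobiForm k 0 f} = ⋃ k, (JSk k : Set Fun) := by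
    ext f
    simp [coe_JSk_eq]
  rw [h, ← iSup_JSk, Submodule.iSup_eq_span]

open MvPolynomial in
/-- A polynomial vanishing on infinitely many points of a polynomial curve vanishes on the curve. -/
lemma eval_eq_zero_of_infinite (Q : MvPolynomial (Fin 3) ℂ) (p q r : Polynomial ℂ)
    {S : Set ℂ} (hS : S.Infinite) (h : ∀ t ∈ S, eval ![p.eval t, q.eval t, r.eval t] Q = 0)
    (t : ℂ) : eval ![p.eval t, q.eval t, r.eval t] Q = 0 := by
  have key (t : ℂ) : (aeval ![p, q, r] Q).eval t = eval ![p.eval t, q.eval t, r.eval t] Q := by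
    have hv : ![p.eval t, q.eval t, r.eval t] =
        fun i ↦ Polynomial.aeval t (![p, q, r] i) := by
      ext i
      fin_cases i <;> simp
    rw [hv, ← Polynomial.coe_aeval_eq_eval, ← MvPolynomial.coe_aeval_eq_eval]
    exact AlgHom.congr_fun (comp_aeval ![p, q, r] (Polynomial.aeval t)) Q
  have h0 : aeval ![p, q, r] Q = 0 :=
    Polynomial.eq_zero_of_infinite_isRoot _ (hS.mono fun t ht ↦ by
      simpa [Polynomial.IsRoot, key] using h t ht)
  rw [← key, h0, Polynomial.eval_zero]

open MvPolynomial in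
-- With `τ` fixed, the infinitely many values of `℘` free the first coordinate.
lemma eval_wp_of_eval_zero {Q : MvPolynomial (Fin 3) ℂ}
    (hQ : ∀ p : Dom, eval ![wp p, eis 4 p.1.1, eis 6 p.1.1] Q = 0) (x : ℂ) (τ : ℍ) :
    eval ![x, eis 4 τ, eis 6 τ] Q = 0 := by
  have h := eval_eq_zero_of_infinite Q .X (.C (eis 4 τ)) (.C (eis 6 τ))
    (periods τ).infinite_image_weierstrassP
  simp only [Polynomial.eval_X, Polynomial.eval_C] at h
  refine h ?_ x
  rintro _ ⟨z, hz, rfl⟩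
  have h' := hQ ⟨(τ, z), hz⟩
  rw [wp_apply] at h'
  exact h'

open MvPolynomial in
-- Moving `τ` in its orbit scales `G₄` and `G₆` by powers of `cτ + d`, which thus becomes a free
-- parameter `T`.
lemma eval_smul_of_eval_eis {Q : MvPolynomial (Fin 3) ℂ}
    (hQ : ∀ (x : ℂ) (τ : ℍ), eval ![x, eis 4 τ, eis 6 τ] Q = 0) (x T : ℂ) (τ : ℍ) :
    eval ![x, T ^ 4 * eis 4 τ, T ^ 6 * eis 6 τ] Q = 0 := by
  have h := eval_eq_zero_of_infinite Q (.C x) (.X ^ 4 * .C (eis 4 τ)) (.X ^ 6 * .C (eis 6 τ))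
    (infinite_range_autFactor τ)
  simp only [Polynomial.eval_mul, Polynomial.eval_pow, Polynomial.eval_X,
    Polynomial.eval_C] at h
  refine h ?_ T
  rintro _ ⟨g, rfl⟩
  have h' := hQ x (g • τ)
  rw [eis_smul, eis_smul] at h'
  exact h'

open MvPolynomial in
lemma eval_cuspidal_of_eval_smul {Q : MvPolynomial (Fin 3) ℂ}
    (hQ : ∀ (x T : ℂ) (τ : ℍ), eval ![x, T ^ 4 * eis 4 τ, T ^ 6 * eis 6 τ] Q = 0)
    (x w u : ℂ) : eval ![x, w ^ 2 * u, w ^ 3 * u] Q = 0 := by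
  have h := eval_eq_zero_of_infinite Q (.C x) (.C (w ^ 2) * .X) (.C (w ^ 3) * .X)
    infinite_range_eis_quotient
  simp only [Polynomial.eval_mul, Polynomial.eval_X, Polynomial.eval_C] at h
  refine h ?_ u
  rintro _ ⟨τ, h4, h6, rfl⟩
  -- With `T² = w G₄ / G₆` the scaled pair becomes `(w²u, w³u)`, where `u = G₄³ / G₆²`.
  obtain ⟨T, hT⟩ := IsAlgClosed.exists_pow_nat_eq (w * eis 4 τ / eis 6 τ) two_pos
  have hT4 : T ^ 4 * eis 4 τ = w ^ 2 * (eis 4 τ ^ 3 / eis 6 τ ^ 2) := by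
    rw [show T ^ 4 = (T ^ 2) ^ 2 by ring, hT]
    field_simp
  have hT6 : T ^ 6 * eis 6 τ = w ^ 3 * (eis 4 τ ^ 3 / eis 6 τ ^ 2) := by
    rw [show T ^ 6 = (T ^ 2) ^ 3 by ring, hT]
    field_simp
  have h' := hQ x T τ
  rwa [hT4, hT6] at h'

open MvPolynomial in
/-- `℘`, `e₄` and `e₆` are algebraically independent. -/
lemma eq_zero_of_eval_wp_eis {Q : MvPolynomial (Fin 3) ℂ}
    (hQ : ∀ p : Dom, eval ![wp p, eis 4 p.1.1, eis 6 p.1.1] Q = 0) : Q = 0 := by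
  have h3 := eval_cuspidal_of_eval_smul (eval_smul_of_eval_eis (eval_wp_of_eval_zero hQ))
  -- The pairs `(w²u, w³u)` reach every point with nonzero last two coordinates; the factors `X 1`
  -- and `X 2` take care of the others.
  have h4 : Q * X 1 * X 2 = 0 := by
    refine MvPolynomial.funext fun v ↦ ?_
    rw [map_mul, map_mul, eval_X, eval_X, map_zero]
    by_cases hy : v 1 = 0
    · rw [hy, mul_zero, zero_mul]
    by_cases hz : v 2 = 0
    · rw [hz, mul_zero]
    have h5 := h3 (v 0) (v 2 / v 1) (v 1 ^ 3 / v 2 ^ 2)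
    have h6 : (v 2 / v 1) ^ 2 * (v 1 ^ 3 / v 2 ^ 2) = v 1 := by field_simp
    have h7 : (v 2 / v 1) ^ 3 * (v 1 ^ 3 / v 2 ^ 2) = v 2 := by field_simp
    have h8 : ![v 0, v 1, v 2] = v := by
      ext i
      fin_cases i <;> rfl
    rw [h6, h7, h8] at h5
    rw [h5, zero_mul, zero_mul]
  exact (mul_eq_zero.mp ((mul_eq_zero.mp h4).resolve_right (X_ne_zero 2))).resolve_right
    (X_ne_zero 1)

open MvPolynomial in
/-- Division with remainder by the Weierstrass equation. -/
lemma exists_weierstrass_decomposition (P : MvPolynomial (Fin 3) ℂ) :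
    ∃ Q₀ Q₁ : MvPolynomial (Fin 3) ℂ, ∀ x y t s : ℂ, y ^ 2 = 4 * x ^ 3 - 60 * t * x - 140 * s →
      eval ![x, y, t] P = eval ![x, t, s] Q₀ + y * eval ![x, t, s] Q₁ := by
  induction P using MvPolynomial.induction_on with
  | C a => exact ⟨C a, 0, fun x y t s _ ↦ by simp⟩
  | add P P' hP hP' =>
    obtain ⟨Q₀, Q₁, h⟩ := hP
    obtain ⟨Q₀', Q₁', h'⟩ := hP'
    refine ⟨Q₀ + Q₀', Q₁ + Q₁', fun x y t s hxy ↦ ?_⟩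
    rw [map_add, map_add, map_add, h x y t s hxy, h' x y t s hxy]
    ring
  | mul_X P i hP =>
    obtain ⟨Q₀, Q₁, h⟩ := hP
    fin_cases i
    · refine ⟨Q₀ * X 0, Q₁ * X 0, fun x y t s hxy ↦ ?_⟩
      simp only [map_mul, eval_X, h x y t s hxy]
      simp
      ring
    -- Multiplication by `y` swaps the two parts, with `y²` replaced by the cubic.
    · refine ⟨Q₁ * (4 * X 0 ^ 3 - 60 * X 1 * X 0 - 140 * X 2), Q₀, fun x y t s hxy ↦ ?_⟩
      simp only [map_mul, eval_X, h x y t s hxy]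
      simp
      linear_combination eval ![x, t, s] Q₁ * hxy
    · refine ⟨Q₀ * X 1, Q₁ * X 1, fun x y t s hxy ↦ ?_⟩
      simp only [map_mul, eval_X, h x y t s hxy]
      simp
      ring

open MvPolynomial in
theorem algebraicIndependent_wp_dwp_e4 : AlgebraicIndependent ℂ ![wp, dwp, e4] := by
  rw [algebraicIndependent_iff]
  intro P hP
  obtain ⟨Q₀, Q₁, hQ⟩ := exists_weierstrass_decomposition P
  have hcurve (p : Dom) : dwp p ^ 2 =
      4 * wp p ^ 3 - 60 * eis 4 p.1.1 * wp p - 140 * eis 6 p.1.1 := by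
    have h := (periods p.1.1).derivWeierstrassP_sq p.1.2 p.2
    rw [← wp_apply, ← dwp_apply] at h
    exact h
  have hval (p : Dom) : eval ![wp p, dwp p, eis 4 p.1.1] P = 0 := by
    have h := AlgHom.congr_fun (comp_aeval ![wp, dwp, e4] (Pi.evalAlgHom ℂ (fun _ : Dom ↦ ℂ) p)) P
    rw [AlgHom.comp_apply, hP, map_zero] at h
    have hv : ![wp p, dwp p, eis 4 p.1.1] =
        fun i ↦ Pi.evalAlgHom ℂ (fun _ : Dom ↦ ℂ) p (![wp, dwp, e4] i) := by
      ext i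
      fin_cases i <;> rfl
    rw [hv, ← MvPolynomial.coe_aeval_eq_eval]
    exact h.symm
  -- the parity of `℘` and its derivative
  have hneg (p : Dom) : eval ![wp p, -dwp p, eis 4 p.1.1] P = 0 := by
    have hz : -p.1.2 ∉ (periods p.1.1).lattice := by simpa using p.2
    have h := hval ⟨(p.1.1, -p.1.2), hz⟩
    rw [wp_apply, dwp_apply] at h
    simpa [wp_apply, dwp_apply] using h
  have hzero (p : Dom) : eval ![wp p, eis 4 p.1.1, eis 6 p.1.1] Q₀ = 0 ∧
      dwp p * eval ![wp p, eis 4 p.1.1, eis 6 p.1.1] Q₁ = 0 := by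
    have h1 := hval p
    have h2 := hneg p
    rw [hQ _ _ _ (eis 6 p.1.1) (hcurve p)] at h1
    rw [hQ _ _ _ (eis 6 p.1.1) (by rw [neg_sq]; exact hcurve p)] at h2
    constructor
    · linear_combination (h1 + h2) / 2
    · linear_combination (h1 - h2) / 2
  have h0 : Q₀ = 0 := eq_zero_of_eval_wp_eis fun p ↦ (hzero p).1
  -- Multiplying by `∂_z ℘` once more turns its square into the cubic, a polynomial in the
  -- independent functions, so its zeros need no separate treatment.
  have h1 : (4 * X 0 ^ 3 - 60 * X 1 * X 0 - 140 * X 2) * Q₁ = 0 :=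
    eq_zero_of_eval_wp_eis fun p ↦ by
      rw [map_mul]
      have h2 : eval ![wp p, eis 4 p.1.1, eis 6 p.1.1]
          (4 * X 0 ^ 3 - 60 * X 1 * X 0 - 140 * X 2) = dwp p ^ 2 := by
        rw [hcurve p]
        simp
      rw [h2, sq, mul_assoc, (hzero p).2, mul_zero]
  have hne : (4 * X 0 ^ 3 - 60 * X 1 * X 0 - 140 * X 2 : MvPolynomial (Fin 3) ℂ) ≠ 0 := by
    intro h
    have := congrArg (eval ![1, 0, 0]) h
    simp at this
  have h2 : Q₁ = 0 := (mul_eq_zero.mp h1).resolve_left hne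
  refine MvPolynomial.funext fun v ↦ ?_
  -- Any point lies on the Weierstrass curve for a suitable `s`, because the equation is linear in
  -- `s`.
  have h3 := hQ (v 0) (v 1) (v 2) ((4 * v 0 ^ 3 - 60 * v 2 * v 0 - v 1 ^ 2) / 140) (by ring)
  have hv : ![v 0, v 1, v 2] = v := by
    ext i
    fin_cases i <;> rfl
  rw [hv, h0, h2] at h3
  simpa using h3

end SingularJacobi

theorem mainTheorem2 :
    AlgebraicIndependent ℂ ![SingularJacobi.wp, SingularJacobi.dwp, SingularJacobi.e4] ∧
    (SetLike.GradedMonoid SingularJacobi.JSk ∧ iSupIndep SingularJacobi.JSk ∧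
      (⨆ k : ℕ, SingularJacobi.JSk k) = Subalgebra.toSubmodule SingularJacobi.JS) ∧
    (∀ k : ℕ, (SingularJacobi.JSk k : Set SingularJacobi.Fun) =
      {f | SingularJacobi.IsSingularJacobiForm k 0 f}) ∧
    Submodule.span ℂ {f : SingularJacobi.Fun | ∃ k : ℕ, SingularJacobi.IsSingularJacobiForm k 0 f} =
      Subalgebra.toSubmodule SingularJacobi.JS :=
  ⟨SingularJacobi.algebraicIndependent_wp_dwp_e4,
    ⟨inferInstance, SingularJacobi.iSupIndep_JSk, SingularJacobi.iSup_JSk⟩,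
    SingularJacobi.coe_JSk_eq, SingularJacobi.span_isSingularJacobiForm⟩
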